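/- For $r>0$ let $B^{2n}(r)=\{(x,y)\in\mathbb{R}^n\times\mathbb{R}^n : \sum_i x_i^2+\sum_i y_i^2< r/\pi\}$ and $Z^{2n}(r)=\{(x,y) : x_1^2+y_1^2<r/\pi\}=B^2(r)\times\mathbb{R}^{2n-2}$, both with the standard symplectic form $\omega_0=\sum_i dy_i\wedge dx_i$. A symplectic capacity $c$ on symplectic manifolds of dimension $2n$ (without boundary) assigns to each of them a number $c(M,\omega)\in[0,\infty]$ such that - (monotonicity) $c(M_1,\omega_1)\le c(M_2,\omega_2)$ whenever there is a symplectic embedding of $(M_1,\omega_1)$ into $(M_2,\omega_2)$ (of the same dimension); - (conformality) $c(M,\lambda\omega)=|\lambda|\,c(M,\omega)$ for all real $\lambda\ne0$; - (non-triviality) $c(B^{2n}(1),\omega_0)>0$ and $c(Z^{2n}(1),\omega_0)<\infty$. It is normalized if $c(B^{2n}(1),\omega_0)=c(Z^{2n}(1),\omega_0)=1$. For $a>0$ let $C_a=\{q\in\mathbb{R}^3 : q_1^2+q_2^2=1,\ |q_3|<a\}$ be the truncated cylinder with the Riemannian metric induced from $\mathbb{R}^3$, and let $$D^*C_a=\{(q,p)\in\mathbb{R}^3\times\mathbb{R}^3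 : q\in C_a,\ q_1p_1+q_2p_2=0,\ |p|^2<1\}$$ be its open unit disk cotangent bundle, a $4$-dimensional submanifold of $T^*\mathbb{R}^3=\mathbb{R}^3\times\mathbb{R}^3$ with the symplectic form given by the restriction of $\sum_i dp_i\wedge dq_i$. **Theorem.** For every normalized symplectic capacity $c$ on $4$-dimensional symplectic manifolds and every $a>0$, $$c(D^*C_a)=\begin{cases}4a & \text{if } a\le\pi,\\ 4\pi & \text{if } a\ge\pi.\end{cases}$$ -/

import Mathlib

open Set Topology
open scoped Manifold ContDiff ENNReal

/-- `ℝ^{2n}` with coordinates `(x, y)`, `x, y ∈ ℝ^n`. Only its topology and smooth structure matter. -/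
abbrev SympSpace (n : ℕ) : Type := (Fin n → ℝ) × (Fin n → ℝ)

/-- The standard symplectic form `ω₀ = ∑ dy_i ∧ dx_i` on `ℝ^{2n}`. -/
noncomputable def stdForm (n : ℕ) : SympSpace n [⋀^Fin 2]→L[ℝ] ℝ where
  toFun v := ∑ i, ((v 0).2 i * (v 1).1 i - (v 0).1 i * (v 1).2 i)
  map_update_add' := by
    intro _ m i x y
    have : ∀ h : DecidableEq (Fin 2), h = instDecidableEqFin 2 := fun h => Subsingleton.elim _ _
    rename_i h
    obtain rfl := this h
    rw [← Finset.sum_add_distrib]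
    refine Finset.sum_congr rfl fun j _ => ?_
    fin_cases i <;> simp <;> ring
  map_update_smul' := by
    intro _ m i c x
    have : ∀ h : DecidableEq (Fin 2), h = instDecidableEqFin 2 := fun h => Subsingleton.elim _ _
    rename_i h
    obtain rfl := this h
    rw [smul_eq_mul, Finset.mul_sum]
    refine Finset.sum_congr rfl fun j _ => ?_
    fin_cases i <;> simp <;> ring
  map_eq_zero_of_eq' := by
    intro v i j hij hne
    have h01 : v 0 = v 1 := by
      fin_cases i <;> fin_cases j <;> first | exact absurd rfl hne | exact hij | exact hij.symm
    refine Finset.sum_eq_zero fun k _ => ?_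
    rw [h01]; ring
  cont := by
    show Continuous fun v : Fin 2 → SympSpace n =>
      ∑ i, ((v 0).2 i * (v 1).1 i - (v 0).1 i * (v 1).2 i)
    fun_prop

theorem stdForm_apply (n : ℕ) (v : Fin 2 → SympSpace n) :
    stdForm n v = ∑ i, ((v 0).2 i * (v 1).1 i - (v 0).1 i * (v 1).2 i) := rfl

theorem stdForm_nondegenerate (n : ℕ) (v : SympSpace n) (hv : ∀ w, stdForm n ![v, w] = 0) :
    v = 0 := by
  simp only [stdForm_apply, Matrix.cons_val_zero, Matrix.cons_val_one] at hv
  ext i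
  · simpa [Pi.single_apply] using hv (0, Pi.single i 1)
  · simpa [Pi.single_apply] using hv (Pi.single i 1, 0)

/-- A `2`-form on a manifold `M` modelled on `ℝ^{2n}`: an alternating bilinear form on every tangent
space. Smoothness is part of `IsSymplecticForm`. -/
abbrev TwoForm (n : ℕ) (M : Type) [TopologicalSpace M] [ChartedSpace (SympSpace n) M] : Type :=
  ∀ x : M, TangentSpace 𝓘(ℝ, SympSpace n) x [⋀^Fin 2]→L[ℝ] ℝ

/-- The expression of a `2`-form in the chart around `x₀`, that is, its pullback under the inverse
of that chart. It is meaningful on the target of the chart. -/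
noncomputable def inChart {n : ℕ} {M : Type} [TopologicalSpace M]
    [ChartedSpace (SympSpace n) M] (Ω : TwoForm n M) (x₀ : M) (y : SympSpace n) :
    SympSpace n [⋀^Fin 2]→L[ℝ] ℝ :=
  (Ω ((extChartAt 𝓘(ℝ, SympSpace n) x₀).symm y)).compContinuousLinearMap
    (mfderiv 𝓘(ℝ, SympSpace n) 𝓘(ℝ, SympSpace n) (extChartAt 𝓘(ℝ, SympSpace n) x₀).symm y)

/-- A symplectic form: a smooth, closed, nondegenerate `2`-form. Smoothness and closedness are
expressed in the charts; the charts around the points cover the manifold. -/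
structure IsSymplecticForm {n : ℕ} {M : Type} [TopologicalSpace M]
    [ChartedSpace (SympSpace n) M] (Ω : TwoForm n M) : Prop where
  smooth : ∀ x₀ : M, ContDiffOn ℝ ∞ (inChart Ω x₀) (extChartAt 𝓘(ℝ, SympSpace n) x₀).target
  closed : ∀ x₀ : M, ∀ y ∈ (extChartAt 𝓘(ℝ, SympSpace n) x₀).target,
    extDeriv (inChart Ω x₀) y = 0
  nondegenerate : ∀ (x : M) (v : TangentSpace 𝓘(ℝ, SympSpace n) x),
    (∀ w, Ω x ![v, w] = 0) → v = 0

/-- A symplectic manifold `(M, Ω)` of dimension `2n` (without boundary): a smooth, Hausdorff, second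
countable manifold modelled on `ℝ^{2n}` with a symplectic form. It may be disconnected. -/
structure SymplecticManifold (n : ℕ) where
  carrier : Type
  [topologicalSpace : TopologicalSpace carrier]
  [chartedSpace : ChartedSpace (SympSpace n) carrier]
  [isManifold : IsManifold 𝓘(ℝ, SympSpace n) ∞ carrier]
  [t2Space : T2Space carrier]
  [secondCountable : SecondCountableTopology carrier]
  form : TwoForm n carrier
  isSymplectic : IsSymplecticForm form

attribute [instance] SymplecticManifold.topologicalSpace SymplecticManifold.chartedSpace
  SymplecticManifold.isManifold SymplecticManifold.t2Space SymplecticManifold.secondCountable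

/-- The pullback `f^*ω₀` of the standard symplectic form of `ℝ^{2m}` under `f : M → ℝ^{2m}`. -/
noncomputable def pullbackStdForm {n m : ℕ} {M : Type} [TopologicalSpace M]
    [ChartedSpace (SympSpace n) M] (f : M → SympSpace m) : TwoForm n M := fun x =>
  (stdForm m).compContinuousLinearMap
    (mfderiv 𝓘(ℝ, SympSpace n) 𝓘(ℝ, SympSpace m) f x : TangentSpace 𝓘(ℝ, SympSpace n) x →L[ℝ] SympSpace m)

theorem contDiff_pullback_two {E F : Type*} [NormedAddCommGroup E] [NormedSpace ℝ E]
    [NormedAddCommGroup F] [NormedSpace ℝ F] (α : F [⋀^Fin 2]→L[ℝ] ℝ) :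
    ContDiff ℝ ∞ (fun A : E →L[ℝ] F => α.compContinuousLinearMap A) := by
  let L₀ : ContinuousMultilinearMap ℝ (fun _ : Fin 2 => E) ℝ →ₗ[ℝ] E [⋀^Fin 2]→L[ℝ] ℝ :=
    { toFun := fun f => (2 : ℝ)⁻¹ • ContinuousMultilinearMap.alternatization f
      map_add' := fun f g => by simp
      map_smul' := fun c f => by
        ext v
        simp [ContinuousMultilinearMap.alternatization_apply_apply, Finset.mul_sum]
        refine Finset.sum_congr rfl fun σ _ => ?_
        simp only [Units.smul_def, zsmul_eq_mul]
        ring }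
  have hL : ∀ f, ‖L₀ f‖ ≤ 1 * ‖f‖ := by
    intro f
    rw [one_mul]
    refine ContinuousAlternatingMap.opNorm_le_bound _ (norm_nonneg f) fun v => ?_
    have h1 : ∀ σ : Equiv.Perm (Fin 2), ‖f (v ∘ σ)‖ ≤ ‖f‖ * ∏ i, ‖v i‖ := fun σ => by
      refine (f.le_opNorm _).trans_eq ?_
      congr 1
      exact Equiv.prod_comp σ (fun i => ‖v i‖)
    show ‖(2 : ℝ)⁻¹ • ContinuousMultilinearMap.alternatization f v‖ ≤ _
    rw [ContinuousMultilinearMap.alternatization_apply_apply, norm_smul]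
    have h2 : ‖∑ σ : Equiv.Perm (Fin 2), Equiv.Perm.sign σ • f (v ∘ σ)‖
        ≤ ∑ σ : Equiv.Perm (Fin 2), ‖f‖ * ∏ i, ‖v i‖ := by
      refine norm_sum_le_of_le _ fun σ _ => ?_
      rcases Int.units_eq_one_or (Equiv.Perm.sign σ) with h | h <;> rw [h] <;>
        simpa using h1 σ
    rw [Finset.sum_const, Finset.card_univ, Fintype.card_perm] at h2
    simp at h2 ⊢
    linarith
  let L := L₀.mkContinuous 1 hL
  have key : (fun A : E →L[ℝ] F => α.compContinuousLinearMap A) = fun A =>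
      L (ContinuousMultilinearMap.compContinuousLinearMapContinuousMultilinear ℝ
        (fun _ : Fin 2 => E) (fun _ => F) ℝ (fun _ => A) α.toContinuousMultilinearMap) := by
    funext A
    ext v
    show _ = (2 : ℝ)⁻¹ • ContinuousMultilinearMap.alternatization
      (ContinuousMultilinearMap.compContinuousLinearMapContinuousMultilinear ℝ
        (fun _ : Fin 2 => E) (fun _ => F) ℝ (fun _ => A) α.toContinuousMultilinearMap) v
    rw [ContinuousMultilinearMap.alternatization_apply_apply]
    have h3 : ∀ σ : Equiv.Perm (Fin 2), Equiv.Perm.sign σ •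
        ((ContinuousMultilinearMap.compContinuousLinearMapContinuousMultilinear ℝ
        (fun _ : Fin 2 => E) (fun _ => F) ℝ (fun _ => A) α.toContinuousMultilinearMap) (v ∘ σ))
        = α (A ∘ v) := by
      intro σ
      have : ((ContinuousMultilinearMap.compContinuousLinearMapContinuousMultilinear ℝ
        (fun _ : Fin 2 => E) (fun _ => F) ℝ (fun _ => A) α.toContinuousMultilinearMap) (v ∘ σ))
        = α ((A ∘ v) ∘ σ) := rfl
      rw [this]
      erw [α.toAlternatingMap.map_perm (A ∘ v) σ]
      rw [smul_smul, Int.units_mul_self, one_smul]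
      rfl
    rw [Finset.sum_congr rfl fun σ _ => h3 σ, Finset.sum_const, Finset.card_univ,
      Fintype.card_perm]
    simp
  rw [key]
  refine L.contDiff.comp ?_
  have h4 : ContDiff ℝ ∞ (fun A : E →L[ℝ] F =>
      ContinuousMultilinearMap.compContinuousLinearMapContinuousMultilinear ℝ
        (fun _ : Fin 2 => E) (fun _ => F) ℝ (fun _ => A)) :=
    (ContinuousMultilinearMap.contDiff _).comp (contDiff_pi.2 fun _ => contDiff_id)
  exact h4.clm_apply contDiff_const

section
variable {n m : ℕ} {M : Type} [TopologicalSpace M] [ChartedSpace (SympSpace n) M]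
  [IsManifold 𝓘(ℝ, SympSpace n) ∞ M]

theorem pullbackStdForm_inChart {f : M → SympSpace m}
    (hf : ContMDiff 𝓘(ℝ, SympSpace n) 𝓘(ℝ, SympSpace m) ∞ f) (x₀ : M) {y : SympSpace n}
    (hy : y ∈ (extChartAt 𝓘(ℝ, SympSpace n) x₀).target) :
    inChart (pullbackStdForm f) x₀ y = (stdForm m).compContinuousLinearMap
      (fderiv ℝ (f ∘ (extChartAt 𝓘(ℝ, SympSpace n) x₀).symm) y) := by
  have h1 : MDifferentiableAt 𝓘(ℝ, SympSpace n) 𝓘(ℝ, SympSpace n)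
      (extChartAt 𝓘(ℝ, SympSpace n) x₀).symm y :=
    (((contMDiffOn_extChartAt_symm (n := ∞) x₀) y hy).contMDiffAt
      ((isOpen_extChartAt_target x₀).mem_nhds hy)).mdifferentiableAt (by simp)
  have h2 := mfderiv_comp y ((hf.mdifferentiable (by simp)) _) h1
  rw [← mfderiv_eq_fderiv, h2]
  rfl

theorem contDiffOn_comp_extChartAt_symm {f : M → SympSpace m}
    (hf : ContMDiff 𝓘(ℝ, SympSpace n) 𝓘(ℝ, SympSpace m) ∞ f) (x₀ : M) :
    ContDiffOn ℝ ∞ (f ∘ (extChartAt 𝓘(ℝ, SympSpace n) x₀).symm)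
      (extChartAt 𝓘(ℝ, SympSpace n) x₀).target :=
  contMDiffOn_iff_contDiffOn.1
    (hf.comp_contMDiffOn (contMDiffOn_extChartAt_symm (n := ∞) x₀))

theorem pullbackStdForm_isSymplectic {f : M → SympSpace m}
    (hf : ContMDiff 𝓘(ℝ, SympSpace n) 𝓘(ℝ, SympSpace m) ∞ f)
    (hnd : ∀ (x : M) (v : TangentSpace 𝓘(ℝ, SympSpace n) x),
      (∀ w, pullbackStdForm f x ![v, w] = 0) → v = 0) :
    IsSymplecticForm (pullbackStdForm f : TwoForm n M) where
  smooth x₀ := by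
    have h := (contDiffOn_comp_extChartAt_symm hf x₀).fderiv_of_isOpen (m := ∞)
      (isOpen_extChartAt_target x₀) (by simp)
    exact ((contDiff_pullback_two (stdForm m)).comp_contDiffOn h).congr
      fun y hy => pullbackStdForm_inChart hf x₀ hy
  closed x₀ y hy := by
    have hev : inChart (pullbackStdForm f) x₀ =ᶠ[𝓝 y] fun y =>
        ((fun _ => stdForm m : SympSpace m → _)
          ((f ∘ (extChartAt 𝓘(ℝ, SympSpace n) x₀).symm) y)).compContinuousLinearMap
        (fderiv ℝ (f ∘ (extChartAt 𝓘(ℝ, SympSpace n) x₀).symm) y) := by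
      filter_upwards [(isOpen_extChartAt_target x₀).mem_nhds hy] with z hz
      exact pullbackStdForm_inChart hf x₀ hz
    rw [hev.extDeriv_eq, extDeriv_pullback (r := ∞) (differentiableAt_const _)
      ((contDiffOn_comp_extChartAt_symm hf x₀).contDiffAt
        ((isOpen_extChartAt_target x₀).mem_nhds hy)) (by simp only [minSmoothness_of_isRCLikeNormedField]; exact WithTop.coe_le_coe.2 le_top)]
    ext v
    simp [extDeriv, ContinuousAlternatingMap.alternatizeUncurryFin_apply]
  nondegenerate := hnd

end

theorem pullbackStdForm_apply_chart {n m : ℕ} {M : Type} [TopologicalSpace M]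
    [ChartedSpace (SympSpace n) M] {f : M → SympSpace m}
    (hf : ContMDiff 𝓘(ℝ, SympSpace n) 𝓘(ℝ, SympSpace m) ∞ f) (x : M) :
    pullbackStdForm (n := n) f x = (stdForm m).compContinuousLinearMap
      (fderiv ℝ (f ∘ (extChartAt 𝓘(ℝ, SympSpace n) x).symm)
        (extChartAt 𝓘(ℝ, SympSpace n) x x)) := by
  have h : mfderiv 𝓘(ℝ, SympSpace n) 𝓘(ℝ, SympSpace m) f x =
      fderiv ℝ (f ∘ (extChartAt 𝓘(ℝ, SympSpace n) x).symm)
        (extChartAt 𝓘(ℝ, SympSpace n) x x) := by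
    have := (hf.mdifferentiable (by simp)) x
    simp [mfderiv, this, writtenInExtChartAt]
    rfl
  unfold pullbackStdForm
  rw [h]
  rfl

/-- An open subset of `ℝ^{2n}`, with the restriction of the standard symplectic form. -/
noncomputable def SymplecticManifold.ofOpen {n : ℕ} (U : TopologicalSpace.Opens (SympSpace n)) :
    SymplecticManifold n where
  carrier := U
  form := pullbackStdForm (Subtype.val : U → SympSpace n)
  isSymplectic := by
    have hval : ContMDiff 𝓘(ℝ, SympSpace n) 𝓘(ℝ, SympSpace n) ∞
      (Subtype.val : U → SympSpace n) := contMDiff_subtype_val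
    refine pullbackStdForm_isSymplectic hval fun x v hv => ?_
    have hd : MDifferentiableAt 𝓘(ℝ, SympSpace n) 𝓘(ℝ, SympSpace n)
        (Subtype.val : U → SympSpace n) x := (hval.mdifferentiable (by simp)) x
    have hfd : fderiv ℝ ((Subtype.val : U → SympSpace n) ∘
        (extChartAt 𝓘(ℝ, SympSpace n) x).symm) (extChartAt 𝓘(ℝ, SympSpace n) x x) =
        ContinuousLinearMap.id ℝ (SympSpace n) := by
      have hev : ((Subtype.val : U → SympSpace n) ∘ (extChartAt 𝓘(ℝ, SympSpace n) x).symm)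
          =ᶠ[𝓝 (extChartAt 𝓘(ℝ, SympSpace n) x x)] id := by
        filter_upwards [(isOpen_extChartAt_target x).mem_nhds (mem_extChartAt_target x)] with z hz
        have := (extChartAt 𝓘(ℝ, SympSpace n) x).right_inv hz
        exact this
      rw [hev.fderiv_eq, fderiv_id]
    rw [pullbackStdForm_apply_chart hval, hfd] at hv
    exact stdForm_nondegenerate n v fun w => hv w

theorem IsSymplecticForm.const_smul {n : ℕ} {M : Type} [TopologicalSpace M]
    [ChartedSpace (SympSpace n) M] {Ω : TwoForm n M} (h : IsSymplecticForm Ω) {l : ℝ}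
    (hl : l ≠ 0) : IsSymplecticForm (fun x => l • Ω x : TwoForm n M) := by
  have key : ∀ x₀ : M, inChart (fun x => l • Ω x : TwoForm n M) x₀ = l • inChart Ω x₀ :=
    fun x₀ => rfl
  refine ⟨fun x₀ => ?_, fun x₀ y hy => ?_, fun x v hv => h.nondegenerate x v fun w => ?_⟩
  · rw [key]
    exact (h.smooth x₀).const_smul l
  · rw [key, extDeriv_smul, h.closed x₀ y hy, smul_zero]
  · have := hv w
    rw [ContinuousAlternatingMap.smul_apply, smul_eq_mul] at this
    exact (mul_eq_zero.1 this).resolve_left hl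

/-- The symplectic manifold `(M, l Ω)`, for `l ≠ 0`. -/
noncomputable def SymplecticManifold.rescale {n : ℕ} (M : SymplecticManifold n) (l : ℝ)
    (hl : l ≠ 0) : SymplecticManifold n where
  carrier := M.carrier
  form x := l • M.form x
  isSymplectic := M.isSymplectic.const_smul hl

/-- `φ : M → N` is a symplectic embedding: a smooth topological embedding with `φ^*Ω_N = Ω_M`
(this identity makes `φ` an immersion). Both manifolds have the same dimension `2n`. -/
structure IsSymplecticEmbedding {n : ℕ} (M N : SymplecticManifold n)
    (φ : M.carrier → N.carrier) : Prop where
  contMDiff : ContMDiff 𝓘(ℝ, SympSpace n) 𝓘(ℝ, SympSpace n) ∞ φ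
  isEmbedding : IsEmbedding φ
  pullback_eq : ∀ x, (N.form (φ x)).compContinuousLinearMap
    (mfderiv 𝓘(ℝ, SympSpace n) 𝓘(ℝ, SympSpace n) φ x) = M.form x

/-- The ball `B^{2n}(r) = {∑ x_i² + ∑ y_i² < r / π}` with `ω₀`. -/
noncomputable def sympBall (n : ℕ) (r : ℝ) : SymplecticManifold n :=
  .ofOpen ⟨{v | ∑ i, v.1 i ^ 2 + ∑ i, v.2 i ^ 2 < r / Real.pi},
    isOpen_lt (by fun_prop) continuous_const⟩

/-- The symplectic cylinder `Z^{2n}(r) = B^2(r) × ℝ^{2n-2} = {x_1² + y_1² < r / π}` with `ω₀`. -/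
noncomputable def sympCylinder (n : ℕ) [NeZero n] (r : ℝ) : SymplecticManifold n :=
  .ofOpen ⟨{v | v.1 0 ^ 2 + v.2 0 ^ 2 < r / Real.pi},
    isOpen_lt (by fun_prop) continuous_const⟩

/-- A symplectic capacity on the symplectic manifolds of dimension `2n`. -/
structure IsSymplecticCapacity (n : ℕ) [NeZero n] (c : SymplecticManifold n → ℝ≥0∞) : Prop where
  monotone : ∀ M N : SymplecticManifold n, (∃ φ, IsSymplecticEmbedding M N φ) → c M ≤ c N
  conformal : ∀ (M : SymplecticManifold n) (l : ℝ) (hl : l ≠ 0),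
    c (M.rescale l hl) = ENNReal.ofReal |l| * c M
  ball_pos : 0 < c (sympBall n 1)
  cylinder_lt_top : c (sympCylinder n 1) < ⊤

/-- A normalized symplectic capacity: `c(B^{2n}(1)) = c(Z^{2n}(1)) = 1`. -/
structure IsNormalizedSymplecticCapacity (n : ℕ) [NeZero n] (c : SymplecticManifold n → ℝ≥0∞) : Prop
    extends IsSymplecticCapacity n c where
  ball_eq_one : c (sympBall n 1) = 1
  cylinder_eq_one : c (sympCylinder n 1) = 1

/-- The truncated cylinder `C_a = {q ∈ ℝ³ | q_1² + q_2² = 1, |q_3| < a}`. -/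
def truncatedCylinder (a : ℝ) : Set (Fin 3 → ℝ) :=
  {q | q 0 ^ 2 + q 1 ^ 2 = 1 ∧ |q 2| < a}

/-- The open unit disk cotangent bundle `D^*C_a` as a subset of `T^*ℝ³ = ℝ³ × ℝ³`, where covectors are
identified with tangent vectors through the metric of `C_a` induced from `ℝ³`: the pairs `(q, p)`
with `q ∈ C_a`, `p` tangent to `C_a` at `q` (orthogonal to the normal `(q_1, q_2, 0)`), `|p| < 1`. -/
def diskCotangentCylinder (a : ℝ) : Set (SympSpace 3) :=
  {x | x.1 ∈ truncatedCylinder a ∧ x.1 0 * x.2 0 + x.1 1 * x.2 1 = 0 ∧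
    x.2 0 ^ 2 + x.2 1 ^ 2 + x.2 2 ^ 2 < 1}

/-- The coordinates `(θ, z; p_θ, p_z)` on `D^*C_a`, with the angle `θ ∈ (-π, π]` measured from the
direction `w` of the unit circle. -/
noncomputable def cylCoord (w : ℂ) (x : SympSpace 3) : SympSpace 2 :=
  (![((⟨x.1 0, x.1 1⟩ : ℂ) * (starRingEnd ℂ) w).arg, x.1 2],
   ![x.1 0 * x.2 1 - x.1 1 * x.2 0, x.2 2])

/-- The inverse of `cylCoord w`: for `u = w e^{iθ}`, the point `q = (u, z)` with the covector
`p = p_θ · (i u, 0) + p_z · (0, 0, 1)`. -/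
noncomputable def cylParam (w : ℂ) (y : SympSpace 2) : SympSpace 3 :=
  (![w.re * Real.cos (y.1 0) - w.im * Real.sin (y.1 0),
     w.re * Real.sin (y.1 0) + w.im * Real.cos (y.1 0), y.1 1],
   ![-(y.2 0 * (w.re * Real.sin (y.1 0) + w.im * Real.cos (y.1 0))),
     y.2 0 * (w.re * Real.cos (y.1 0) - w.im * Real.sin (y.1 0)), y.2 1])

theorem contDiff_cylParam (w : ℂ) : ContDiff ℝ ∞ (cylParam w) := by
  unfold cylParam
  refine ContDiff.prodMk (contDiff_pi.2 fun i => ?_) (contDiff_pi.2 fun i => ?_) <;>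
    fin_cases i <;> simp <;> fun_prop

theorem contDiffAt_cylCoord (w : ℂ) {x : SympSpace 3}
    (hx : (⟨x.1 0, x.1 1⟩ : ℂ) * (starRingEnd ℂ) w ∈ Complex.slitPlane) :
    ContDiffAt ℝ ∞ (cylCoord w) x := by
  have h0 : ContDiff ℝ ∞ fun x : SympSpace 3 => (⟨x.1 0, x.1 1⟩ : ℂ) * (starRingEnd ℂ) w := by
    have : (fun x : SympSpace 3 => (⟨x.1 0, x.1 1⟩ : ℂ) * (starRingEnd ℂ) w) =
        fun x => (Complex.ofRealCLM (x.1 0) + Complex.ofRealCLM (x.1 1) * Complex.I)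
          * (starRingEnd ℂ) w := by
      funext x; congr 1; apply Complex.ext <;> simp
    rw [this]
    have h1 : ContDiff ℝ ∞ fun x : SympSpace 3 => Complex.ofRealCLM (x.1 0) :=
      Complex.ofRealCLM.contDiff.comp (by fun_prop)
    have h2 : ContDiff ℝ ∞ fun x : SympSpace 3 => Complex.ofRealCLM (x.1 1) :=
      Complex.ofRealCLM.contDiff.comp (by fun_prop)
    exact (h1.add (h2.mul contDiff_const)).mul contDiff_const
  have h1 : ContDiffAt ℝ ∞
      (fun x : SympSpace 3 => ((⟨x.1 0, x.1 1⟩ : ℂ) * (starRingEnd ℂ) w).arg) x := by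
    have h2 : ContDiffAt ℝ ∞ Complex.log ((⟨x.1 0, x.1 1⟩ : ℂ) * (starRingEnd ℂ) w) :=
      (Complex.contDiffAt_log hx).restrict_scalars ℝ
    have h3 := (Complex.imCLM.contDiff (n := ∞)).contDiffAt.comp x
      (h2.comp x h0.contDiffAt)
    refine h3.congr_of_eventuallyEq (Filter.Eventually.of_forall fun z => ?_)
    simp [Complex.log_im]
  unfold cylCoord
  refine ContDiffAt.prodMk (contDiffAt_pi.2 fun i => ?_) (contDiffAt_pi.2 fun i => ?_) <;>
    fin_cases i
  · exact h1
  · simp; fun_prop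
  · simp; fun_prop
  · simp; fun_prop

/-- The range of the coordinates `(θ, z, p_θ, p_z)`. -/
def cylTarget (a : ℝ) : Set (SympSpace 2) :=
  {y | y.1 0 ∈ Ioo (-Real.pi) Real.pi ∧ |y.1 1| < a ∧ y.2 0 ^ 2 + y.2 1 ^ 2 < 1}

theorem cylParam_mem {a : ℝ} {w : ℂ} (hw : ‖w‖ = 1) {y : SympSpace 2} (h1 : |y.1 1| < a)
    (h2 : y.2 0 ^ 2 + y.2 1 ^ 2 < 1) : cylParam w y ∈ diskCotangentCylinder a := by
  have hw' : w.re ^ 2 + w.im ^ 2 = 1 := by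
    have := Complex.sq_norm w
    rw [hw, Complex.normSq_apply] at this
    nlinarith
  have hcs := Real.sin_sq_add_cos_sq (y.1 0)
  refine ⟨⟨?_, ?_⟩, ?_, ?_⟩
  · simp [cylParam]
    linear_combination (w.re ^ 2 + w.im ^ 2) * hcs + hw'
  · simpa [cylParam] using h1
  · simp [cylParam]; ring
  · simp [cylParam]
    have : (y.2 0 * (w.re * Real.sin (y.1 0) + w.im * Real.cos (y.1 0))) ^ 2 +
      (y.2 0 * (w.re * Real.cos (y.1 0) - w.im * Real.sin (y.1 0))) ^ 2 = y.2 0 ^ 2 := by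
      linear_combination (y.2 0) ^ 2 * (w.re ^ 2 + w.im ^ 2) * hcs + (y.2 0) ^ 2 * hw'
    linarith

theorem cylParam_mul_conj {w : ℂ} (hw : ‖w‖ = 1) (y : SympSpace 2) :
    (⟨(cylParam w y).1 0, (cylParam w y).1 1⟩ : ℂ) * (starRingEnd ℂ) w =
      Complex.exp ((y.1 0 : ℝ) * Complex.I) := by
  have hw' : w.re ^ 2 + w.im ^ 2 = 1 := by
    have := Complex.sq_norm w
    rw [hw, Complex.normSq_apply] at this
    nlinarith
  apply Complex.ext
  · simp [cylParam, Complex.exp_ofReal_mul_I_re]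
    linear_combination Real.cos (y.1 0) * hw'
  · simp [cylParam, Complex.exp_ofReal_mul_I_im]
    linear_combination Real.sin (y.1 0) * hw'

theorem cylCoord_cylParam {w : ℂ} (hw : ‖w‖ = 1) {y : SympSpace 2}
    (hy : y.1 0 ∈ Ioo (-Real.pi) Real.pi) : cylCoord w (cylParam w y) = y := by
  have hw' : w.re ^ 2 + w.im ^ 2 = 1 := by
    have := Complex.sq_norm w
    rw [hw, Complex.normSq_apply] at this
    nlinarith
  have hcs := Real.sin_sq_add_cos_sq (y.1 0)
  have harg : ((⟨(cylParam w y).1 0, (cylParam w y).1 1⟩ : ℂ) * (starRingEnd ℂ) w).arg = y.1 0 := by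
    rw [cylParam_mul_conj hw, Complex.exp_mul_I,
      Complex.arg_cos_add_sin_mul_I ⟨hy.1, hy.2.le⟩]
  unfold cylCoord
  rw [harg]
  refine Prod.ext (funext fun i => ?_) (funext fun i => ?_) <;> fin_cases i
  · rfl
  · simp [cylParam]
  · simp [cylParam]
    linear_combination (y.2 0) * (w.re ^ 2 + w.im ^ 2) * hcs + (y.2 0) * hw'
  · simp [cylParam]

theorem cylParam_cylCoord {a : ℝ} {w : ℂ} (hw : ‖w‖ = 1) {x : SympSpace 3}
    (hx : x ∈ diskCotangentCylinder a) : cylParam w (cylCoord w x) = x := by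
  obtain ⟨⟨h1, h2⟩, h3, h4⟩ := hx
  have hw' : w.re ^ 2 + w.im ^ 2 = 1 := by
    have := Complex.sq_norm w
    rw [hw, Complex.normSq_apply] at this
    nlinarith
  set u : ℂ := (⟨x.1 0, x.1 1⟩ : ℂ) * (starRingEnd ℂ) w with hu
  have hun : ‖u‖ = 1 := by
    have h5 : ‖(⟨x.1 0, x.1 1⟩ : ℂ)‖ = 1 := by
      rw [Complex.norm_def, Complex.normSq_apply, Real.sqrt_eq_one]
      simp; nlinarith
    rw [hu, norm_mul, Complex.norm_conj, h5, hw, one_mul]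
  have hu0 : u ≠ 0 := by
    intro h; rw [h] at hun; simp at hun
  have hc : Real.cos u.arg = x.1 0 * w.re + x.1 1 * w.im := by
    rw [Complex.cos_arg hu0, hun, hu]; simp
  have hs : Real.sin u.arg = x.1 1 * w.re - x.1 0 * w.im := by
    rw [Complex.sin_arg, hun, hu]; simp; ring
  have e0 : w.re * Real.cos u.arg - w.im * Real.sin u.arg = x.1 0 := by
    rw [hc, hs]; linear_combination x.1 0 * hw'
  have e1 : w.re * Real.sin u.arg + w.im * Real.cos u.arg = x.1 1 := by
    rw [hc, hs]; linear_combination x.1 1 * hw'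
  refine Prod.ext (funext fun i => ?_) (funext fun i => ?_) <;> fin_cases i
  · simpa [cylParam, cylCoord] using e0
  · simpa [cylParam, cylCoord] using e1
  · simp [cylParam, cylCoord]
  · simp only [cylParam, cylCoord, ← hu]
    simp [e0, e1]
    linear_combination x.2 0 * h1 - x.1 0 * h3
  · simp only [cylParam, cylCoord, ← hu]
    simp [e0, e1]
    linear_combination x.2 1 * h1 - x.1 1 * h3
  · simp [cylParam, cylCoord]

theorem cylCoord_mem {a : ℝ} {w : ℂ} {x : SympSpace 3} (hx : x ∈ diskCotangentCylinder a)
    (hs : (⟨x.1 0, x.1 1⟩ : ℂ) * (starRingEnd ℂ) w ∈ Complex.slitPlane) :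
    cylCoord w x ∈ cylTarget a := by
  obtain ⟨⟨h1, h2⟩, h3, h4⟩ := hx
  refine ⟨⟨?_, ?_⟩, ?_, ?_⟩
  · simpa [cylCoord] using Complex.neg_pi_lt_arg _
  · have := (Complex.mem_slitPlane_iff_arg.1 hs).1
    simpa [cylCoord] using lt_of_le_of_ne (Complex.arg_le_pi _) this
  · simpa [cylCoord] using h2
  · have : (x.1 0 * x.2 1 - x.1 1 * x.2 0) ^ 2 = x.2 0 ^ 2 + x.2 1 ^ 2 := by
      linear_combination (x.2 0 ^ 2 + x.2 1 ^ 2) * h1 - (x.1 0 * x.2 0 + x.1 1 * x.2 1) * h3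
    simp [cylCoord]
    linarith

/-- The direction `(q_1, q_2)` of the base point of `(q, p) ∈ D^*C_a`, as a unit complex number. -/
def cylBase {a : ℝ} (x₀ : diskCotangentCylinder a) : ℂ := ⟨x₀.1.1 0, x₀.1.1 1⟩

theorem norm_cylBase {a : ℝ} (x₀ : diskCotangentCylinder a) : ‖cylBase x₀‖ = 1 := by
  rw [Complex.norm_def, Complex.normSq_apply, Real.sqrt_eq_one]
  have := x₀.2.1.1
  simp only [cylBase]
  nlinarith

open Classical in
/-- The chart of `D^*C_a` by `(θ, z; p_θ, p_z)` around `x₀`, away from the opposite line `θ = π`. -/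
noncomputable def cylChart (a : ℝ) (x₀ : diskCotangentCylinder a) :
    OpenPartialHomeomorph (diskCotangentCylinder a) (SympSpace 2) where
  toFun x := cylCoord (cylBase x₀) x
  invFun y := if h : |y.1 1| < a ∧ y.2 0 ^ 2 + y.2 1 ^ 2 < 1 then
      ⟨cylParam (cylBase x₀) y, cylParam_mem (norm_cylBase x₀) h.1 h.2⟩ else x₀
  source := {x | (⟨x.1.1 0, x.1.1 1⟩ : ℂ) * (starRingEnd ℂ) (cylBase x₀) ∈ Complex.slitPlane}
  target := cylTarget a
  map_source' x hx := cylCoord_mem x.2 hx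
  map_target' y hy := by
    rw [dif_pos hy.2]
    show _ ∈ Complex.slitPlane
    rw [cylParam_mul_conj (norm_cylBase x₀), Complex.mem_slitPlane_iff_arg, Complex.exp_mul_I,
      Complex.arg_cos_add_sin_mul_I ⟨hy.1.1, hy.1.2.le⟩]
    refine ⟨hy.1.2.ne, ?_⟩
    rw [← Complex.exp_mul_I]
    exact Complex.exp_ne_zero _
  left_inv' x hx := by
    rw [dif_pos (cylCoord_mem x.2 hx).2]
    exact Subtype.ext (cylParam_cylCoord (norm_cylBase x₀) x.2)
  right_inv' y hy := by
    rw [dif_pos hy.2]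
    exact cylCoord_cylParam (norm_cylBase x₀) hy.1
  continuousOn_toFun := fun x hx =>
    ((contDiffAt_cylCoord _ hx).continuousAt.comp
      continuous_subtype_val.continuousAt).continuousWithinAt
  continuousOn_invFun := by
    rw [continuousOn_iff_continuous_domRestrict, Topology.IsInducing.subtypeVal.continuous_iff]
    refine ((contDiff_cylParam (cylBase x₀)).continuous.comp continuous_subtype_val).congr ?_
    intro y
    have := y.2.2
    simp [this]
  open_source := by
    refine Complex.isOpen_slitPlane.preimage (Continuous.mul ?_ continuous_const)
    refine Complex.equivRealProdCLM.symm.continuous.comp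
      (f := fun x : diskCotangentCylinder a => (x.1.1 0, x.1.1 1)) ?_
    fun_prop
  open_target := by
    refine IsOpen.inter (isOpen_Ioo.preimage (by fun_prop)) (IsOpen.inter ?_ ?_)
    · exact isOpen_lt (f := fun y : SympSpace 2 => |y.1 1|) (by fun_prop) continuous_const
    · exact isOpen_lt (f := fun y : SympSpace 2 => y.2 0 ^ 2 + y.2 1 ^ 2) (by fun_prop)
        continuous_const

theorem cylChart_symm_val {a : ℝ} (x₀ : diskCotangentCylinder a) {y : SympSpace 2}
    (hy : y ∈ cylTarget a) : ((cylChart a x₀).symm y : SympSpace 3) = cylParam (cylBase x₀) y := by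
  have h := hy.2
  show ((if h : |y.1 1| < a ∧ y.2 0 ^ 2 + y.2 1 ^ 2 < 1 then
      (⟨cylParam (cylBase x₀) y, cylParam_mem (norm_cylBase x₀) h.1 h.2⟩ :
        diskCotangentCylinder a) else x₀ : diskCotangentCylinder a) : SympSpace 3) = _
  rw [dif_pos h]

/-- The smooth structure of `D^*C_a` as a submanifold of `ℝ³ × ℝ³`. -/
noncomputable instance cylChartedSpace (a : ℝ) :
    ChartedSpace (SympSpace 2) (diskCotangentCylinder a) where
  atlas := range (cylChart a)
  chartAt := cylChart a
  mem_chart_source x := by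
    show cylBase x * (starRingEnd ℂ) (cylBase x) ∈ Complex.slitPlane
    rw [Complex.mul_conj, Complex.normSq_eq_norm_sq, norm_cylBase]
    simp
  chart_mem_atlas x := ⟨x, rfl⟩

instance cylIsManifold (a : ℝ) :
    IsManifold 𝓘(ℝ, SympSpace 2) ∞ (diskCotangentCylinder a) := by
  refine isManifold_of_contDiffOn _ _ _ ?_
  rintro _ _ ⟨x₀, rfl⟩ ⟨x₁, rfl⟩
  intro y hy
  have hy1 : y ∈ cylTarget a := hy.1.1
  have hy2 : (cylChart a x₀).symm y ∈ (cylChart a x₁).source := hy.1.2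
  have hy3 : (⟨(cylParam (cylBase x₀) y).1 0, (cylParam (cylBase x₀) y).1 1⟩ : ℂ) *
      (starRingEnd ℂ) (cylBase x₁) ∈ Complex.slitPlane := by
    rw [← cylChart_symm_val x₀ hy1]; exact hy2
  have h : ContDiffAt ℝ ∞ (cylCoord (cylBase x₁) ∘ cylParam (cylBase x₀)) y :=
    (contDiffAt_cylCoord _ hy3).comp y (contDiff_cylParam _).contDiffAt
  refine h.contDiffWithinAt.congr_of_eventuallyEq_of_mem ?_ hy
  filter_upwards [self_mem_nhdsWithin] with z hz
  have hz1 : z ∈ cylTarget a := hz.1.1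
  show cylCoord (cylBase x₁) ((cylChart a x₀).symm z : SympSpace 3) = _
  rw [cylChart_symm_val x₀ hz1]
  rfl

theorem contMDiff_cylInclusion (a : ℝ) : ContMDiff 𝓘(ℝ, SympSpace 2) 𝓘(ℝ, SympSpace 3) ∞
    (Subtype.val : diskCotangentCylinder a → SympSpace 3) := by
  rw [contMDiff_iff]
  refine ⟨continuous_subtype_val, fun x _ y hy => ?_⟩
  refine (contDiff_cylParam (cylBase x)).contDiffAt.contDiffWithinAt.congr_of_eventuallyEq_of_mem
    ?_ hy
  filter_upwards [self_mem_nhdsWithin] with z hz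
  have hz1 : z ∈ (cylChart a x).target := by
    have h := hz.1
    rw [extChartAt_target] at h
    exact h.1
  exact cylChart_symm_val x hz1

theorem stdForm_fderiv_cylParam {w : ℂ} (hw : ‖w‖ = 1) (y : SympSpace 2) :
    (stdForm 3).compContinuousLinearMap (fderiv ℝ (cylParam w) y) = stdForm 2 := by
  have hw' : w.re ^ 2 + w.im ^ 2 = 1 := by
    have := Complex.sq_norm w
    rw [hw, Complex.normSq_apply] at this
    nlinarith
  have hcs := Real.sin_sq_add_cos_sq (y.1 0)
  set S := w.re * Real.sin (y.1 0) + w.im * Real.cos (y.1 0) with hS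
  set C := w.re * Real.cos (y.1 0) - w.im * Real.sin (y.1 0) with hC
  have hSC : C ^ 2 + S ^ 2 = 1 := by
    rw [hS, hC]; linear_combination (w.re ^ 2 + w.im ^ 2) * hcs + hw'
  have key : ∀ v : SympSpace 2, fderiv ℝ (cylParam w) y v =
      (![-(S * v.1 0), C * v.1 0, v.1 1],
       ![-(v.2 0 * S + y.2 0 * (C * v.1 0)), v.2 0 * C - y.2 0 * (S * v.1 0), v.2 1]) := by
    intro v
    have hdiff : DifferentiableAt ℝ (cylParam w) y :=
      (contDiff_cylParam w).contDiffAt.differentiableAt (by simp)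
    -- differentiate along the line `t ↦ y + t v`
    have h1 : HasDerivAt (fun t : ℝ => cylParam w (y + t • v)) (fderiv ℝ (cylParam w) y v) 0 := by
      have hl : HasDerivAt (fun t : ℝ => y + t • v) v 0 := by
        simpa using ((hasDerivAt_id (0 : ℝ)).smul_const v).const_add y
      have : HasFDerivAt (cylParam w) (fderiv ℝ (cylParam w) y) (y + (0 : ℝ) • v) := by
        simpa using hdiff.hasFDerivAt
      exact this.comp_hasDerivAt 0 hl
    refine h1.unique ?_
    have hl : ∀ c d : ℝ, HasDerivAt (fun t : ℝ => c + t * d) d 0 := fun c d => by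
      simpa using ((hasDerivAt_id (0 : ℝ)).mul_const d).const_add c
    have hsin : HasDerivAt (fun t : ℝ => Real.sin (y.1 0 + t * v.1 0))
        (Real.cos (y.1 0) * v.1 0) 0 := by simpa using (hl (y.1 0) (v.1 0)).sin
    have hcos : HasDerivAt (fun t : ℝ => Real.cos (y.1 0 + t * v.1 0))
        (-Real.sin (y.1 0) * v.1 0) 0 := by simpa using (hl (y.1 0) (v.1 0)).cos
    have hCd : HasDerivAt (fun t : ℝ => w.re * Real.cos (y.1 0 + t * v.1 0) -
        w.im * Real.sin (y.1 0 + t * v.1 0)) (-(S * v.1 0)) 0 := by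
      convert! (hcos.const_mul w.re).sub (hsin.const_mul w.im) using 1
      rw [hS]; ring
    have hSd : HasDerivAt (fun t : ℝ => w.re * Real.sin (y.1 0 + t * v.1 0) +
        w.im * Real.cos (y.1 0 + t * v.1 0)) (C * v.1 0) 0 := by
      convert! (hsin.const_mul w.re).add (hcos.const_mul w.im) using 1
      rw [hC]; ring
    refine HasDerivAt.prodMk (hasDerivAt_pi.2 fun i => ?_) (hasDerivAt_pi.2 fun i => ?_) <;>
      fin_cases i
    · exact hCd
    · exact hSd
    · exact hl _ _
    · have := ((hl (y.2 0) (v.2 0)).mul hSd).neg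
      simp only [zero_mul, add_zero, ← hS] at this
      exact this
    · have := (hl (y.2 0) (v.2 0)).mul hCd
      simp only [zero_mul, add_zero, ← hC] at this
      convert! this using 1
      simp; ring
    · exact hl _ _
  ext v
  show stdForm 3 (fun i => fderiv ℝ (cylParam w) y (v i)) = _
  simp only [stdForm_apply, key, Fin.sum_univ_three, Fin.sum_univ_two]
  simp
  linear_combination ((v 0).2 0 * (v 1).1 0 - (v 0).1 0 * (v 1).2 0) * hSC

/-- `D^*C_a` as a symplectic manifold: the symplectic form is the restriction of `∑ dp_i ∧ dq_i`
to the submanifold `D^*C_a` of `T^*ℝ³`. -/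
noncomputable def diskCotangentBundle (a : ℝ) : SymplecticManifold 2 where
  carrier := diskCotangentCylinder a
  form := pullbackStdForm (Subtype.val : diskCotangentCylinder a → SympSpace 3)
  isSymplectic := by
    refine pullbackStdForm_isSymplectic (contMDiff_cylInclusion a) fun x v hv => ?_
    have hfd : fderiv ℝ ((Subtype.val : diskCotangentCylinder a → SympSpace 3) ∘
        (extChartAt 𝓘(ℝ, SympSpace 2) x).symm) (extChartAt 𝓘(ℝ, SympSpace 2) x x) =
        fderiv ℝ (cylParam (cylBase x)) (extChartAt 𝓘(ℝ, SympSpace 2) x x) := by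
      refine Filter.EventuallyEq.fderiv_eq ?_
      filter_upwards [(isOpen_extChartAt_target x).mem_nhds (mem_extChartAt_target x)] with z hz
      have hz1 : z ∈ (cylChart a x).target := by
        rw [extChartAt_target] at hz
        exact hz.1
      exact cylChart_symm_val x hz1
    rw [pullbackStdForm_apply_chart (contMDiff_cylInclusion a), hfd,
      stdForm_fderiv_cylParam (norm_cylBase x)] at hv
    exact stdForm_nondegenerate 2 v fun w => hv w

/-! ### Symplectic embeddings into open subsets of `ℝ^{2n}` -/

/-! In the coordinates `(θ, z; p_θ, p_z)` the form on `D^*C_a` is standard, with `θ` defined modulo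
`2π`, `|z| < a` and `p_θ² + p_z² < 1`. A normalized capacity is squeezed between balls that embed
into this space and symplectic cylinders that receive it. All embeddings are built from area
preserving maps of coordinate planes.

Upper bounds. Dropping the coupling of the momenta leaves `|p_θ| < 1` and `|p_z| < 1`, so the space
sits in a product of an annulus of area `4π` and a rectangle of area `4a`. The annulus `(θ, p_θ)`
becomes a punctured disc of area `4π` in polar coordinates of squared radius `2 (p_θ + 1)`
(`cylPlane`). The rectangle `(z, p_z)` becomes a slit disc of area `4a` under `polarMap (π / a) 0`.
Taking one or the other disc as the first factor gives embeddings into `Z(4π)` and `Z(4a)`.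

Lower bound, for `a ≤ π`. Cutting along `θ = π` leaves `cylTarget a`, which contains the product of
the square `(-a, a)²` and `{|p_1| + |p_2| < 1}`. Every ball `B(r)` with `r < 4a` embeds into that
product. Each coordinate plane is mapped to a strip so that the circle of action `I = (x² + y²) / 2`
becomes a level curve of an oscillator with potential `k² tan² q`. As `k → 0` this potential tends
to a square well, whose level curves are rectangles of half-height proportional to `I`; hence a
bound on `I_1 + I_2` becomes a bound on `|p_1| + |p_2|`. A positive `k` keeps the map smooth at the
origin and costs an arbitrarily small amount of capacity. For `a ≥ π` the sub-cylinder of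
half-length `π` already yields `4π`. -/

theorem isEmbedding_of_comp_continuousOn {X Y Z : Type*} [TopologicalSpace X] [TopologicalSpace Y]
    [TopologicalSpace Z] {f : X → Y} {g : Y → Z} (hf : Continuous f)
    (hg : ContinuousOn g (range f)) (hgf : IsEmbedding (g ∘ f)) : IsEmbedding f := by
  have h : IsEmbedding (rangeFactorization f) :=
    IsEmbedding.of_comp (hf.subtype_mk _) (continuousOn_iff_continuous_domRestrict.1 hg) hgf
  exact IsEmbedding.subtypeVal.comp h

theorem pullbackStdForm_comp {n m : ℕ} {M N : Type} [TopologicalSpace M]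
    [ChartedSpace (SympSpace n) M] [TopologicalSpace N] [ChartedSpace (SympSpace n) N]
    {φ : M → N} {f : N → SympSpace m} (hφ : ContMDiff 𝓘(ℝ, SympSpace n) 𝓘(ℝ, SympSpace n) ∞ φ)
    (hf : ContMDiff 𝓘(ℝ, SympSpace n) 𝓘(ℝ, SympSpace m) ∞ f) (x : M) :
    (pullbackStdForm (n := n) f (φ x)).compContinuousLinearMap
      (mfderiv 𝓘(ℝ, SympSpace n) 𝓘(ℝ, SympSpace n) φ x) = pullbackStdForm (n := n) (f ∘ φ) x := by
  unfold pullbackStdForm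
  rw [mfderiv_comp x (hf.mdifferentiable (by simp) _) (hφ.mdifferentiable (by simp) _)]
  rfl

/-- The inclusion of an open set reflects smoothness and embeddings and induces its form, so
everything can be checked on the map into the ambient vector space. -/
theorem isSymplecticEmbedding_ofOpen {n : ℕ} {M : SymplecticManifold n}
    {V : TopologicalSpace.Opens (SympSpace n)} {F : M.carrier → SympSpace n}
    (hF : ContMDiff 𝓘(ℝ, SympSpace n) 𝓘(ℝ, SympSpace n) ∞ F) (hFe : IsEmbedding F)
    (hFV : ∀ x, F x ∈ V) (hform : ∀ x, pullbackStdForm (n := n) F x = M.form x) :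
    IsSymplecticEmbedding M (.ofOpen V) (fun x => (⟨F x, hFV x⟩ : V)) := by
  have hs : ContMDiff 𝓘(ℝ, SympSpace n) 𝓘(ℝ, SympSpace n) ∞ (fun x => (⟨F x, hFV x⟩ : V)) :=
    (ContMDiff.subtypeVal_comp_iff V _).1 hF
  refine ⟨hs, IsEmbedding.of_comp hs.continuous continuous_subtype_val hFe, fun x => ?_⟩
  rw [← hform x]
  exact pullbackStdForm_comp hs contMDiff_subtype_val x

/-- The chart of an open subset is its inclusion, so the manifold derivative is the ordinary Fréchet
derivative. -/
theorem pullbackStdForm_restrict {n m : ℕ} {U : TopologicalSpace.Opens (SympSpace n)}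
    {f : SympSpace n → SympSpace m} (hf : ContMDiff 𝓘(ℝ, SympSpace n) 𝓘(ℝ, SympSpace m) ∞
      (fun x : U => f x)) (x : U) :
    pullbackStdForm (n := n) (fun x : U => f x) x =
      (stdForm m).compContinuousLinearMap (fderiv ℝ f x) := by
  rw [pullbackStdForm_apply_chart hf]
  have hev : (fun x : U => f x) ∘ (extChartAt 𝓘(ℝ, SympSpace n) x).symm
      =ᶠ[𝓝 (extChartAt 𝓘(ℝ, SympSpace n) x x)] f := by
    filter_upwards [(isOpen_extChartAt_target x).mem_nhds (mem_extChartAt_target x)] with z hz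
    exact congrArg f ((extChartAt 𝓘(ℝ, SympSpace n) x).right_inv hz)
  rw [hev.fderiv_eq]
  rfl

theorem ofOpen_form {n : ℕ} (U : TopologicalSpace.Opens (SympSpace n)) (x : U) :
    (SymplecticManifold.ofOpen U).form x = stdForm n := by
  have h := pullbackStdForm_restrict (U := U) (f := id) contMDiff_subtype_val x
  rw [fderiv_id] at h
  exact h

theorem contMDiff_restrict {n m : ℕ} {U : TopologicalSpace.Opens (SympSpace n)}
    {f : SympSpace n → SympSpace m} (hf : ∀ x ∈ U, ContDiffAt ℝ ∞ f x) :
    ContMDiff 𝓘(ℝ, SympSpace n) 𝓘(ℝ, SympSpace m) ∞ (fun x : U => f x) := fun x =>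
  ContMDiffAt.comp x (hf x x.2).contMDiffAt contMDiff_subtype_val.contMDiffAt

/-- Working criterion on open sets: a left inverse that is continuous on the image alone replaces
the verification that the map is an embedding. -/
theorem exists_isSymplecticEmbedding_rescale_ofOpen {n : ℕ}
    {U V : TopologicalSpace.Opens (SympSpace n)} {l : ℝ} (hl : l ≠ 0)
    {f g : SympSpace n → SympSpace n} (hf : ∀ x ∈ U, ContDiffAt ℝ ∞ f x) (hfV : MapsTo f U V)
    (hg : ContinuousOn g (f '' U)) (hgf : LeftInvOn g f U)
    (hform : ∀ x ∈ U, (stdForm n).compContinuousLinearMap (fderiv ℝ f x) = l • stdForm n) :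
    ∃ φ, IsSymplecticEmbedding ((SymplecticManifold.ofOpen U).rescale l hl) (.ofOpen V) φ := by
  have hs := contMDiff_restrict hf
  refine ⟨_, isSymplecticEmbedding_ofOpen (M := (SymplecticManifold.ofOpen U).rescale l hl)
    (F := fun x : U => f x) hs ?_ (fun x : U => hfV x.2) fun x : U => ?_⟩
  · refine isEmbedding_of_comp_continuousOn hs.continuous (hg.mono ?_) (?_ : IsEmbedding (g ∘ _))
    · rintro _ ⟨x, rfl⟩
      exact mem_image_of_mem f x.2
    · convert! (IsEmbedding.subtypeVal : IsEmbedding (Subtype.val : U → SympSpace n)) using 1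
      exact funext fun x => hgf x.2
  · refine (pullbackStdForm_restrict hs x).trans ((hform x x.2).trans ?_)
    exact congrArg (l • ·) (ofOpen_form U x).symm

theorem exists_isSymplecticEmbedding_ofOpen {n : ℕ}
    {U V : TopologicalSpace.Opens (SympSpace n)}
    {f g : SympSpace n → SympSpace n} (hf : ∀ x ∈ U, ContDiffAt ℝ ∞ f x) (hfV : MapsTo f U V)
    (hg : ContinuousOn g (f '' U)) (hgf : LeftInvOn g f U)
    (hform : ∀ x ∈ U, (stdForm n).compContinuousLinearMap (fderiv ℝ f x) = stdForm n) :
    ∃ φ, IsSymplecticEmbedding (.ofOpen U) (.ofOpen V) φ := by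
  obtain ⟨φ, h⟩ := exists_isSymplecticEmbedding_rescale_ofOpen (V := V) one_ne_zero hf hfV hg hgf
    fun x hx => (hform x hx).trans (one_smul ℝ _).symm
  exact ⟨φ, h.contMDiff, h.isEmbedding, fun x => (h.pullback_eq x).trans (one_smul ℝ _)⟩

/-! ### Capacities of balls and cylinders -/

theorem stdForm_comp_fderiv_smul {n : ℕ} (s : ℝ) (x : SympSpace n) :
    (stdForm n).compContinuousLinearMap (fderiv ℝ (fun y : SympSpace n => s • y) x) =
      s ^ 2 • stdForm n := by
  have h : fderiv ℝ (fun y : SympSpace n => s • y) x = s • ContinuousLinearMap.id ℝ _ :=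
    ((hasFDerivAt_id x).const_smul s).fderiv
  ext v
  rw [h]
  simp [stdForm_apply]
  rw [← Finset.sum_sub_distrib, ← Finset.sum_sub_distrib, Finset.mul_sum]
  exact Finset.sum_congr rfl fun i _ => by ring

theorem exists_isSymplecticEmbedding_smul {n : ℕ} {U V : TopologicalSpace.Opens (SympSpace n)}
    {s : ℝ} (hs : s ≠ 0) (hUV : ∀ x ∈ U, s • x ∈ V) :
    ∃ φ, IsSymplecticEmbedding ((SymplecticManifold.ofOpen U).rescale (s ^ 2) (pow_ne_zero 2 hs))
      (.ofOpen V) φ := by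
  refine exists_isSymplecticEmbedding_rescale_ofOpen _ (g := fun y => s⁻¹ • y)
    (fun x _ => (contDiff_id.const_smul s).contDiffAt) hUV (by fun_prop) (fun x _ => ?_)
    fun x _ => stdForm_comp_fderiv_smul s x
  simp [smul_smul, hs]

section
variable {n : ℕ} [NeZero n] {c : SymplecticManifold n → ℝ≥0∞}

/-- Scaling by `√r` multiplies `ω₀` by `r` and sends `B(1)` into `B(r)`; conformality turns this
into the bound. -/
theorem IsNormalizedSymplecticCapacity.le_ball (hc : IsNormalizedSymplecticCapacity n c) {r : ℝ}
    (hr : 0 < r) : ENNReal.ofReal r ≤ c (sympBall n r) := by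
  have hs : √r ≠ 0 := (Real.sqrt_pos.2 hr).ne'
  have h := hc.monotone _ _ (exists_isSymplecticEmbedding_smul (n := n)
    (U := ⟨{v | ∑ i, v.1 i ^ 2 + ∑ i, v.2 i ^ 2 < 1 / Real.pi},
      isOpen_lt (by fun_prop) continuous_const⟩)
    (V := ⟨{v | ∑ i, v.1 i ^ 2 + ∑ i, v.2 i ^ 2 < r / Real.pi},
      isOpen_lt (by fun_prop) continuous_const⟩) hs fun x hx => by
        have hx : ∑ i, x.1 i ^ 2 + ∑ i, x.2 i ^ 2 < 1 / Real.pi := hx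
        show ∑ i, (√r * x.1 i) ^ 2 + ∑ i, (√r * x.2 i) ^ 2 < r / Real.pi
        simp only [mul_pow, Real.sq_sqrt hr.le, ← Finset.mul_sum, ← mul_add]
        rw [div_eq_mul_one_div]
        exact mul_lt_mul_of_pos_left hx hr)
  rw [hc.conformal] at h
  have h1 := hc.ball_eq_one
  unfold sympBall at h1
  rwa [h1, mul_one, Real.sq_sqrt hr.le, abs_of_pos hr] at h

theorem IsNormalizedSymplecticCapacity.cylinder_le (hc : IsNormalizedSymplecticCapacity n c)
    {r : ℝ} (hr : 0 < r) : c (sympCylinder n r) ≤ ENNReal.ofReal r := by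
  have hs : (√r)⁻¹ ≠ 0 := inv_ne_zero (Real.sqrt_pos.2 hr).ne'
  have h := hc.monotone _ _ (exists_isSymplecticEmbedding_smul (n := n)
    (U := ⟨{v | v.1 0 ^ 2 + v.2 0 ^ 2 < r / Real.pi}, isOpen_lt (by fun_prop) continuous_const⟩)
    (V := ⟨{v | v.1 0 ^ 2 + v.2 0 ^ 2 < 1 / Real.pi}, isOpen_lt (by fun_prop) continuous_const⟩)
    hs fun x hx => by
        have hx : x.1 0 ^ 2 + x.2 0 ^ 2 < r / Real.pi := hx
        show ((√r)⁻¹ * x.1 0) ^ 2 + ((√r)⁻¹ * x.2 0) ^ 2 < 1 / Real.pi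
        simp only [mul_pow, inv_pow, Real.sq_sqrt hr.le, ← mul_add]
        rw [inv_mul_lt_iff₀ hr]
        simpa [div_eq_mul_inv] using hx)
  rw [hc.conformal] at h
  have h1 := hc.cylinder_eq_one
  unfold sympCylinder at h1 ⊢
  rw [h1, inv_pow, Real.sq_sqrt hr.le, abs_of_pos (inv_pos.2 hr), ENNReal.ofReal_inv_of_pos hr] at h
  have hr0 : ENNReal.ofReal r ≠ 0 := by simpa using hr
  calc _ = ENNReal.ofReal r * ((ENNReal.ofReal r)⁻¹ * _) := by
        rw [← mul_assoc, ENNReal.mul_inv_cancel hr0 ENNReal.ofReal_ne_top, one_mul]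
    _ ≤ ENNReal.ofReal r * 1 := by gcongr
    _ = _ := mul_one _

end

/-! ### Area preserving maps of the plane and their products -/

/-- `f` is smooth at `z` and its derivative there has determinant `1`. -/
def IsAreaPreservingAt (f : ℝ × ℝ → ℝ × ℝ) (z : ℝ × ℝ) : Prop :=
  ContDiffAt ℝ ∞ f z ∧ ∀ v w : ℝ × ℝ,
    (fderiv ℝ f z v).2 * (fderiv ℝ f z w).1 - (fderiv ℝ f z v).1 * (fderiv ℝ f z w).2 =
      v.2 * w.1 - v.1 * w.2

theorem isAreaPreservingAt_of_hasDerivAt {f : ℝ × ℝ → ℝ × ℝ} {z d₁ d₂ : ℝ × ℝ}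
    (hf : ContDiffAt ℝ ∞ f z) (h₁ : HasDerivAt (fun t => f (t, z.2)) d₁ z.1)
    (h₂ : HasDerivAt (fun t => f (z.1, t)) d₂ z.2) (hdet : d₁.1 * d₂.2 - d₂.1 * d₁.2 = 1) :
    IsAreaPreservingAt f z := by
  refine ⟨hf, fun v w => ?_⟩
  have hd : HasFDerivAt f (fderiv ℝ f z) z := (hf.differentiableAt (by simp)).hasFDerivAt
  have e₁ : fderiv ℝ f z (1, 0) = d₁ := by
    have : HasDerivAt (fun t : ℝ => (t, z.2)) (1, 0) z.1 :=
      (hasDerivAt_id z.1).prodMk (hasDerivAt_const _ _)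
    exact (HasFDerivAt.comp_hasDerivAt z.1 hd this).unique h₁
  have e₂ : fderiv ℝ f z (0, 1) = d₂ := by
    have : HasDerivAt (fun t : ℝ => (z.1, t)) (0, 1) z.2 :=
      (hasDerivAt_const _ _).prodMk (hasDerivAt_id z.2)
    exact (HasFDerivAt.comp_hasDerivAt z.2 hd this).unique h₂
  have e : ∀ v : ℝ × ℝ, fderiv ℝ f z v = v.1 • d₁ + v.2 • d₂ := fun v => by
    rw [← e₁, ← e₂, ← map_smul, ← map_smul, ← map_add]
    congr 1
    ext <;> simp
  simp only [e, Prod.fst_add, Prod.snd_add, Prod.smul_fst, Prod.smul_snd, smul_eq_mul]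
  linear_combination (v.2 * w.1 - v.1 * w.2) * hdet

/-- The product of the plane maps `f i`, applied to the coordinates of index `e i`. -/
def planeProd {n : ℕ} (e : Equiv.Perm (Fin n)) (f : Fin n → ℝ × ℝ → ℝ × ℝ) (y : SympSpace n) :
    SympSpace n :=
  (fun i => (f i (y.1 (e i), y.2 (e i))).1, fun i => (f i (y.1 (e i), y.2 (e i))).2)

section
variable {n : ℕ} {e : Equiv.Perm (Fin n)} {f : Fin n → ℝ × ℝ → ℝ × ℝ} {y : SympSpace n}

theorem contDiffAt_planeProd (h : ∀ i, ContDiffAt ℝ ∞ (f i) (y.1 (e i), y.2 (e i))) :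
    ContDiffAt ℝ ∞ (planeProd e f) y := by
  have h' : ∀ i, ContDiffAt ℝ ∞ (fun y : SympSpace n => f i (y.1 (e i), y.2 (e i))) y := fun i =>
    ContDiffAt.comp (f := fun y : SympSpace n => (y.1 (e i), y.2 (e i))) y (h i)
      (ContDiff.contDiffAt (by fun_prop))
  exact (contDiffAt_pi.2 fun i => (h' i).fst).prodMk (contDiffAt_pi.2 fun i => (h' i).snd)

/-- `ω₀` is the sum of the area forms of the coordinate planes. Each factor preserves its area form,
and permuting the planes only reorders the sum. -/
theorem stdForm_comp_fderiv_planeProd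
    (h : ∀ i, IsAreaPreservingAt (f i) (y.1 (e i), y.2 (e i))) :
    (stdForm n).compContinuousLinearMap (fderiv ℝ (planeProd e f) y) = stdForm n := by
  have hd : ∀ i, DifferentiableAt ℝ (f i) (y.1 (e i), y.2 (e i)) := fun i =>
    (h i).1.differentiableAt (by simp)
  have key : ∀ v, fderiv ℝ (planeProd e f) y v =
      (fun i => (fderiv ℝ (f i) (y.1 (e i), y.2 (e i)) (v.1 (e i), v.2 (e i))).1,
        fun i => (fderiv ℝ (f i) (y.1 (e i), y.2 (e i)) (v.1 (e i), v.2 (e i))).2) := by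
    intro v
    have hF := ((contDiffAt_planeProd fun i => (h i).1).differentiableAt
      (by simp : (∞ : WithTop ℕ∞) ≠ 0)).hasFDerivAt
    have h₁ : HasDerivAt (fun t : ℝ => planeProd e f (y + t • v))
        (fderiv ℝ (planeProd e f) y v) 0 := by
      have hl : HasDerivAt (fun t : ℝ => y + t • v) v 0 := by
        simpa using ((hasDerivAt_id (0 : ℝ)).smul_const v).const_add y
      exact HasFDerivAt.comp_hasDerivAt 0 (by simpa using hF) hl
    refine h₁.unique ?_
    have h₂ : ∀ i, HasDerivAt
        (fun t : ℝ => f i ((y + t • v).1 (e i), (y + t • v).2 (e i)))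
        (fderiv ℝ (f i) (y.1 (e i), y.2 (e i)) (v.1 (e i), v.2 (e i))) 0 := by
      intro i
      have hl : ∀ c d : ℝ, HasDerivAt (fun t : ℝ => c + t * d) d 0 := fun c d => by
        simpa using ((hasDerivAt_id (0 : ℝ)).mul_const d).const_add c
      exact HasFDerivAt.comp_hasDerivAt (l := f i) 0 (by simpa using (hd i).hasFDerivAt)
        ((hl (y.1 (e i)) (v.1 (e i))).prodMk (hl (y.2 (e i)) (v.2 (e i))))
    exact (hasDerivAt_pi.2 fun i => (h₂ i).fst).prodMk (hasDerivAt_pi.2 fun i => (h₂ i).snd)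
  ext v
  show stdForm n (fun i => fderiv ℝ (planeProd e f) y (v i)) = _
  simp only [stdForm_apply, key, (h _).2]
  exact Equiv.sum_comp e fun i => (v 0).2 i * (v 1).1 i - (v 0).1 i * (v 1).2 i

end

theorem isAreaPreservingAt_id (z : ℝ × ℝ) : IsAreaPreservingAt id z :=
  ⟨contDiffAt_id, fun v w => by simp⟩

/-! ### Polar coordinates of unit Jacobian -/

/-- The map with `(2 (p + 1) / b, b q + s)` as squared radius and angle. -/
noncomputable def polarMap (b s : ℝ) (z : ℝ × ℝ) : ℝ × ℝ :=
  (√(2 * (z.2 + 1) / b) * Real.sin (b * z.1 + s), √(2 * (z.2 + 1) / b) * Real.cos (b * z.1 + s))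

/-- With `R² = 2 (p + 1) / b` one has `R ∂R/∂p = 1 / b`, which cancels the angular speed `b`. The
sine stands first so that the determinant is `1` and not `-1`. -/
theorem isAreaPreservingAt_polarMap {b : ℝ} (hb : 0 < b) (s : ℝ) {z : ℝ × ℝ} (hz : -1 < z.2) :
    IsAreaPreservingAt (polarMap b s) z := by
  have hpos : 0 < 2 * (z.2 + 1) / b := div_pos (by linarith) hb
  have hsm : ContDiffAt ℝ ∞ (fun z : ℝ × ℝ => √(2 * (z.2 + 1) / b)) z :=
    ContDiffAt.sqrt (ContDiff.contDiffAt (by fun_prop)) hpos.ne'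
  have hR := Real.sqrt_pos.2 hpos
  have hsq := Real.sq_sqrt hpos.le
  have hcs := Real.sin_sq_add_cos_sq (b * z.1 + s)
  have hl : HasDerivAt (fun t : ℝ => b * t + s) b z.1 := by
    simpa using ((hasDerivAt_id z.1).const_mul b).add_const s
  have hr : HasDerivAt (fun t : ℝ => √(2 * (t + 1) / b)) (2 / b / (2 * √(2 * (z.2 + 1) / b)))
      z.2 := by
    refine HasDerivAt.sqrt ?_ hpos.ne'
    simpa using (((hasDerivAt_id z.2).add_const 1).const_mul 2).div_const b
  have h₁ : HasDerivAt (fun t => polarMap b s (t, z.2))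
      (√(2 * (z.2 + 1) / b) * (Real.cos (b * z.1 + s) * b),
        √(2 * (z.2 + 1) / b) * (-Real.sin (b * z.1 + s) * b)) z.1 := by
    simp only [polarMap]
    exact (hl.sin.const_mul _).prodMk (hl.cos.const_mul _)
  have h₂ : HasDerivAt (fun t => polarMap b s (z.1, t))
      (2 / b / (2 * √(2 * (z.2 + 1) / b)) * Real.sin (b * z.1 + s),
        2 / b / (2 * √(2 * (z.2 + 1) / b)) * Real.cos (b * z.1 + s)) z.2 := by
    simp only [polarMap]
    exact (hr.mul_const _).prodMk (hr.mul_const _)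
  refine isAreaPreservingAt_of_hasDerivAt
    (ContDiffAt.prodMk (hsm.mul (ContDiff.contDiffAt (by fun_prop)))
      (hsm.mul (ContDiff.contDiffAt (by fun_prop)))) h₁ h₂ ?_
  simp only
  generalize √(2 * (z.2 + 1) / b) = R at *
  field_simp
  linear_combination hcs

/-! ### Area preserving maps from discs to almost-rectangles -/

/-- For `I = (x² + y²) / 2`, the map `(x, y) ↦ (q, p)` that gives `(2 I, arg (y + i x))` as
action-angle coordinates of the Hamiltonian `p² + k² tan² q`, followed by `(q, p) ↦ (b q, p / b)`. -/
noncomputable def squaringMap (k b : ℝ) (z : ℝ × ℝ) : ℝ × ℝ :=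
  (b * Real.arcsin (z.1 * √(((z.1 ^ 2 + z.2 ^ 2) / 2 + 2 * k) / 2) /
      ((z.1 ^ 2 + z.2 ^ 2) / 2 + k)),
    z.2 * √(((z.1 ^ 2 + z.2 ^ 2) / 2 + 2 * k) / 2) /
      (b * √(1 - (z.1 * √(((z.1 ^ 2 + z.2 ^ 2) / 2 + 2 * k) / 2) /
      ((z.1 ^ 2 + z.2 ^ 2) / 2 + k)) ^ 2)))

/-- The inverse of `squaringMap k b`. -/
noncomputable def squaringInv (k b : ℝ) (z : ℝ × ℝ) : ℝ × ℝ :=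
  (√((b * z.2) ^ 2 + k ^ 2 / Real.cos (z.1 / b) ^ 2) * Real.sin (z.1 / b) /
      √((√((b * z.2) ^ 2 + k ^ 2 / Real.cos (z.1 / b) ^ 2) + k) / 2),
    b * z.2 * Real.cos (z.1 / b) /
      √((√((b * z.2) ^ 2 + k ^ 2 / Real.cos (z.1 / b) ^ 2) + k) / 2))

/-- Write `I = (x² + y²) / 2`, `m² = (I + 2k) / 2` and `n = I + k`. The factor `m` is chosen so that
`(x² + y²) m² = n² - k²`. Since `k > 0`, the argument of `arcsin` therefore stays strictly inside
`(-1, 1)`. -/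
theorem one_sub_sq_squaring {k : ℝ} (hk : 0 < k) (z : ℝ × ℝ) :
    1 - (z.1 * √(((z.1 ^ 2 + z.2 ^ 2) / 2 + 2 * k) / 2) / ((z.1 ^ 2 + z.2 ^ 2) / 2 + k)) ^ 2 =
      (k ^ 2 + (z.2 * √(((z.1 ^ 2 + z.2 ^ 2) / 2 + 2 * k) / 2)) ^ 2) /
        ((z.1 ^ 2 + z.2 ^ 2) / 2 + k) ^ 2 := by
  have hm : √(((z.1 ^ 2 + z.2 ^ 2) / 2 + 2 * k) / 2) ^ 2 = ((z.1 ^ 2 + z.2 ^ 2) / 2 + 2 * k) / 2 :=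
    Real.sq_sqrt (by positivity)
  rw [div_pow, eq_div_iff (by positivity), sub_mul, div_mul_cancel₀ _ (by positivity), mul_pow,
    mul_pow, hm]
  ring

theorem one_sub_sq_squaring_pos {k : ℝ} (hk : 0 < k) (z : ℝ × ℝ) :
    0 < 1 - (z.1 * √(((z.1 ^ 2 + z.2 ^ 2) / 2 + 2 * k) / 2) /
      ((z.1 ^ 2 + z.2 ^ 2) / 2 + k)) ^ 2 := by
  rw [one_sub_sq_squaring hk]
  positivity

/-- Derivative along one variable of the change of coordinates `(S, T) ↦ (b arcsin S, T / (b √(1 -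
S²)))`; it serves both partial derivatives of `squaringMap`. -/
theorem hasDerivAt_arcsin_div_sqrt {S T : ℝ → ℝ} {S' T' t b : ℝ} (hb : 0 < b)
    (hS : HasDerivAt S S' t) (hT : HasDerivAt T T' t) (hC : 0 < 1 - S t ^ 2) :
    HasDerivAt (fun t => ((b * Real.arcsin (S t), T t / (b * √(1 - S t ^ 2))) : ℝ × ℝ))
      (b * (1 / √(1 - S t ^ 2) * S'),
        (T' * (1 - S t ^ 2) + T t * S t * S') / (b * √(1 - S t ^ 2) ^ 3)) t := by
  have hR := Real.sqrt_pos.2 hC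
  have hsq := Real.sq_sqrt hC.le
  have hr : HasDerivAt (fun t => √(1 - S t ^ 2)) (-(2 * S t * S') / (2 * √(1 - S t ^ 2))) t := by
    refine HasDerivAt.sqrt ?_ hC.ne'
    simpa using (hS.pow 2).const_sub 1
  have h := ((Real.hasDerivAt_arcsin (by nlinarith) (by nlinarith)).comp t hS).const_mul b
  refine h.prodMk ?_
  convert! hT.div (hr.const_mul b) (by positivity) using 1
  rw [show T' * (1 - S t ^ 2) = T' * √(1 - S t ^ 2) ^ 2 by rw [hsq]]
  generalize √(1 - S t ^ 2) = R at *
  field_simp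
  ring

theorem isAreaPreservingAt_squaringMap {k : ℝ} (hk : 0 < k) (z : ℝ × ℝ) {b : ℝ} (hb : 0 < b) :
    IsAreaPreservingAt (squaringMap k b) z := by
  have hC := one_sub_sq_squaring_pos hk z
  have hm0 : 0 < ((z.1 ^ 2 + z.2 ^ 2) / 2 + 2 * k) / 2 := by positivity
  have hn0 : 0 < (z.1 ^ 2 + z.2 ^ 2) / 2 + k := by positivity
  have hm := Real.sqrt_pos.2 hm0
  have hmsq := Real.sq_sqrt hm0.le
  have hR := Real.sqrt_pos.2 hC
  have hRsq := Real.sq_sqrt hC.le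
  have hsm : ContDiffAt ℝ ∞ (fun z : ℝ × ℝ => √(((z.1 ^ 2 + z.2 ^ 2) / 2 + 2 * k) / 2)) z :=
    ContDiffAt.sqrt (ContDiff.contDiffAt (by fun_prop)) hm0.ne'
  have hsS : ContDiffAt ℝ ∞ (fun z : ℝ × ℝ => z.1 * √(((z.1 ^ 2 + z.2 ^ 2) / 2 + 2 * k) / 2) /
      ((z.1 ^ 2 + z.2 ^ 2) / 2 + k)) z :=
    (contDiffAt_fst.mul hsm).div (ContDiff.contDiffAt (by fun_prop)) hn0.ne'
  have hs : ContDiffAt ℝ ∞ (squaringMap k b) z := by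
    refine ContDiffAt.prodMk (contDiffAt_const.mul
      ((Real.contDiffAt_arcsin (by nlinarith) (by nlinarith)).comp z hsS))
      ((contDiffAt_snd.mul hsm).div (contDiffAt_const.mul
        (ContDiffAt.sqrt (contDiffAt_const.sub (hsS.pow 2)) hC.ne')) (by positivity))
  have hI₁ : HasDerivAt (fun t => (t ^ 2 + z.2 ^ 2) / 2) z.1 z.1 := by
    simpa using ((hasDerivAt_pow 2 z.1).add_const (z.2 ^ 2)).div_const 2
  have hI₂ : HasDerivAt (fun t => (z.1 ^ 2 + t ^ 2) / 2) z.2 z.2 := by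
    simpa using ((hasDerivAt_pow 2 z.2).const_add (z.1 ^ 2)).div_const 2
  have hm₁ := ((hI₁.add_const (2 * k)).div_const 2).sqrt hm0.ne'
  have hm₂ := ((hI₂.add_const (2 * k)).div_const 2).sqrt hm0.ne'
  have hS₁ := ((hasDerivAt_id z.1).mul hm₁).div (hI₁.add_const k) hn0.ne'
  have hS₂ := (hm₂.const_mul z.1).div (hI₂.add_const k) hn0.ne'
  have hT₁ := hm₁.const_mul z.2
  have hT₂ := (hasDerivAt_id z.2).mul hm₂
  refine isAreaPreservingAt_of_hasDerivAt hs (hasDerivAt_arcsin_div_sqrt hb hS₁ hT₁ hC)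
    (hasDerivAt_arcsin_div_sqrt hb hS₂ hT₂ hC) ?_
  -- Passing from `(S, T)` to `(q, p)` divides areas by `1 - S²`, with `b` cancelling. It remains to
  -- see that `(x, y) ↦ (S, T)` has Jacobian `1 - S²`.
  have hdet : ∀ R S T S₁ S₂ T₁ T₂ : ℝ, 0 < R → R ^ 2 = 1 - S ^ 2 → S₁ * T₂ - S₂ * T₁ = 1 - S ^ 2 →
      b * (1 / R * S₁) * ((T₂ * (1 - S ^ 2) + T * S * S₂) / (b * R ^ 3)) -
      b * (1 / R * S₂) * ((T₁ * (1 - S ^ 2) + T * S * S₁) / (b * R ^ 3)) = 1 := by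
    intro R S T S₁ S₂ T₁ T₂ hR h h'
    rw [← h] at h' ⊢
    field_simp
    linear_combination R ^ 2 * h'
  refine hdet _ _ _ _ _ _ _ hR hRsq ?_
  have hk' : k = 2 * √(((z.1 ^ 2 + z.2 ^ 2) / 2 + 2 * k) / 2) ^ 2 / 2 - (z.1 ^ 2 + z.2 ^ 2) / 4 := by
    rw [hmsq]; ring
  simp only [Pi.mul_apply, id]
  generalize √(((z.1 ^ 2 + z.2 ^ 2) / 2 + 2 * k) / 2) = m at *
  -- Since `I + k = m² + I / 2`, `k` can be eliminated in favour of `m`, and the claim becomes a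
  -- rational identity in `x`, `y`, `m`.
  have hn' : (z.1 ^ 2 + z.2 ^ 2) / 2 + k = m ^ 2 + (z.1 ^ 2 + z.2 ^ 2) / 4 := by
    rw [hmsq]; ring
  rw [hn'] at hn0 ⊢
  field_simp
  ring

theorem squaringInv_squaringMap {k : ℝ} (hk : 0 < k) {b : ℝ} (hb : 0 < b) (z : ℝ × ℝ) :
    squaringInv k b (squaringMap k b z) = z := by
  have hC := one_sub_sq_squaring_pos hk z
  have hC' := one_sub_sq_squaring hk z
  have hm0 : 0 < ((z.1 ^ 2 + z.2 ^ 2) / 2 + 2 * k) / 2 := by positivity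
  have hn0 : 0 < (z.1 ^ 2 + z.2 ^ 2) / 2 + k := by positivity
  have hm := Real.sqrt_pos.2 hm0
  have hR := Real.sqrt_pos.2 hC
  have hRsq := Real.sq_sqrt hC.le
  have hnk : (z.1 ^ 2 + z.2 ^ 2) / 2 + k + k = (z.1 ^ 2 + z.2 ^ 2) / 2 + 2 * k := by ring
  -- Energy recovers the action: `(b p)² + k² / cos² (q / b) = (I + k)²`. Then `m` is known from `I
  -- + 2k = (I + k) + k`, and `x`, `y` follow by division.
  have h1 : √((b * (z.2 * √(((z.1 ^ 2 + z.2 ^ 2) / 2 + 2 * k) / 2) /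
      (b * √(1 - (z.1 * √(((z.1 ^ 2 + z.2 ^ 2) / 2 + 2 * k) / 2) /
        ((z.1 ^ 2 + z.2 ^ 2) / 2 + k)) ^ 2)))) ^ 2 +
      k ^ 2 / √(1 - (z.1 * √(((z.1 ^ 2 + z.2 ^ 2) / 2 + 2 * k) / 2) /
        ((z.1 ^ 2 + z.2 ^ 2) / 2 + k)) ^ 2) ^ 2) = (z.1 ^ 2 + z.2 ^ 2) / 2 + k := by
    rw [Real.sqrt_eq_iff_mul_self_eq_of_pos hn0, ← mul_div_assoc, mul_div_mul_left _ _ hb.ne',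
      div_pow, hRsq, ← add_div, hC', eq_div_iff (by positivity)]
    field_simp
    ring
  unfold squaringInv squaringMap
  simp only [mul_div_cancel_left₀ _ hb.ne']
  rw [Real.cos_arcsin, Real.sin_arcsin (by nlinarith) (by nlinarith), h1, hnk]
  ext
  · simp only
    field_simp
  · simp only
    rw [← mul_div_assoc, mul_div_mul_left _ _ hb.ne', div_mul_cancel₀ _ hR.ne',
      mul_div_cancel_right₀ _ hm.ne']

/-- Kinetic energy is at most total energy: `(b p)²` is `(I + k)²` minus a nonnegative term. This is
the sense in which discs go almost into rectangles. -/
theorem mul_abs_squaringMap_snd_le {k : ℝ} (hk : 0 < k) {b : ℝ} (hb : 0 < b) (z : ℝ × ℝ) :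
    b * |(squaringMap k b z).2| ≤ (z.1 ^ 2 + z.2 ^ 2) / 2 + k := by
  have hC := one_sub_sq_squaring_pos hk z
  have hC' := one_sub_sq_squaring hk z
  have hn0 : 0 < (z.1 ^ 2 + z.2 ^ 2) / 2 + k := by positivity
  have hR := Real.sqrt_pos.2 hC
  have hRsq := Real.sq_sqrt hC.le
  rw [← abs_of_pos hb, ← abs_mul, abs_of_pos hb]
  refine abs_le_of_sq_le_sq ?_ hn0.le
  unfold squaringMap
  simp only
  rw [← mul_div_assoc, mul_div_mul_left _ _ hb.ne', div_pow, hRsq, div_le_iff₀ hC, hC',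
    mul_div_cancel₀ _ (by positivity)]
  nlinarith [sq_nonneg k]

theorem abs_squaringMap_fst_lt {k : ℝ} (hk : 0 < k) {b : ℝ} (hb : 0 < b) (z : ℝ × ℝ) :
    |(squaringMap k b z).1| < b * (Real.pi / 2) := by
  have hC := one_sub_sq_squaring_pos hk z
  unfold squaringMap
  rw [abs_mul, abs_of_pos hb]
  refine mul_lt_mul_of_pos_left (abs_lt.2 ⟨?_, ?_⟩) hb
  · rw [Real.neg_pi_div_two_lt_arcsin]; nlinarith
  · rw [Real.arcsin_lt_pi_div_two]; nlinarith

theorem continuousAt_squaringInv {k : ℝ} (hk : 0 < k) {b : ℝ} {z : ℝ × ℝ}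
    (hz : Real.cos (z.1 / b) ≠ 0) : ContinuousAt (squaringInv k b) z := by
  have hn : ContinuousAt (fun z : ℝ × ℝ => √((b * z.2) ^ 2 + k ^ 2 / Real.cos (z.1 / b) ^ 2)) z :=
    ContinuousAt.sqrt (by fun_prop (disch := positivity))
  have hm : ContinuousAt (fun z : ℝ × ℝ =>
      √((√((b * z.2) ^ 2 + k ^ 2 / Real.cos (z.1 / b) ^ 2) + k) / 2)) z :=
    ((hn.add continuousAt_const).div_const 2).sqrt
  exact ((hn.mul (by fun_prop)).div hm (by positivity)).prodMk
    (ContinuousAt.div (by fun_prop) hm (by positivity))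

/-! ### Symplectic embeddings from and into `D^*C_a` -/

theorem extChartAt_mem_cylTarget {a : ℝ} (x : diskCotangentCylinder a) :
    extChartAt 𝓘(ℝ, SympSpace 2) x x ∈ cylTarget a := by
  have h := mem_extChartAt_target (I := 𝓘(ℝ, SympSpace 2)) x
  rw [extChartAt_target] at h
  exact h.1

theorem pullbackStdForm_cyl {a : ℝ} {m : ℕ} {F : SympSpace 3 → SympSpace m}
    (hF : ContMDiff 𝓘(ℝ, SympSpace 2) 𝓘(ℝ, SympSpace m) ∞
      (fun x : diskCotangentCylinder a => F x)) (x : diskCotangentCylinder a) :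
    pullbackStdForm (n := 2) (fun x : diskCotangentCylinder a => F x) x =
      (stdForm m).compContinuousLinearMap
        (fderiv ℝ (F ∘ cylParam (cylBase x)) (extChartAt 𝓘(ℝ, SympSpace 2) x x)) := by
  rw [pullbackStdForm_apply_chart hF]
  have hev : (fun x : diskCotangentCylinder a => F x) ∘ (extChartAt 𝓘(ℝ, SympSpace 2) x).symm
      =ᶠ[𝓝 (extChartAt 𝓘(ℝ, SympSpace 2) x x)] F ∘ cylParam (cylBase x) := by
    filter_upwards [(isOpen_extChartAt_target x).mem_nhds (mem_extChartAt_target x)] with z hz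
    rw [extChartAt_target] at hz
    exact congrArg F (cylChart_symm_val x hz.1)
  rw [hev.fderiv_eq]

theorem diskCotangentBundle_form {a : ℝ} (x : diskCotangentCylinder a) :
    (diskCotangentBundle a).form x = stdForm 2 :=
  (pullbackStdForm_cyl (F := id) (contMDiff_cylInclusion a) x).trans
    (stdForm_fderiv_cylParam (norm_cylBase x) _)

/-- The form of `D^*C_a` is standard in every angular chart, so the symplectic condition on `F` is
tested after composing with each `cylParam w`. -/
theorem exists_isSymplecticEmbedding_diskCotangentBundle_ofOpen {a : ℝ}
    {V : TopologicalSpace.Opens (SympSpace 2)} {F : SympSpace 3 → SympSpace 2}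
    {g : SympSpace 2 → SympSpace 3} (hF : ∀ x ∈ diskCotangentCylinder a, ContDiffAt ℝ ∞ F x)
    (hFV : MapsTo F (diskCotangentCylinder a) V)
    (hg : ContinuousOn g (F '' diskCotangentCylinder a))
    (hgF : LeftInvOn g F (diskCotangentCylinder a))
    (hform : ∀ w : ℂ, ‖w‖ = 1 → ∀ y ∈ cylTarget a,
      (stdForm 2).compContinuousLinearMap (fderiv ℝ (F ∘ cylParam w) y) = stdForm 2) :
    ∃ φ, IsSymplecticEmbedding (diskCotangentBundle a) (.ofOpen V) φ := by
  have hs : ContMDiff 𝓘(ℝ, SympSpace 2) 𝓘(ℝ, SympSpace 2) ∞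
      (fun x : diskCotangentCylinder a => F x) := fun x =>
    ContMDiffAt.comp x (hF x x.2).contMDiffAt (contMDiff_cylInclusion a).contMDiffAt
  refine ⟨_, isSymplecticEmbedding_ofOpen (M := diskCotangentBundle a)
    (F := fun x : diskCotangentCylinder a => F x) hs ?_
    (fun x : diskCotangentCylinder a => hFV x.2) fun x : diskCotangentCylinder a => ?_⟩
  · refine isEmbedding_of_comp_continuousOn hs.continuous (hg.mono ?_) (?_ : IsEmbedding (g ∘ _))
    · rintro _ ⟨x, rfl⟩
      exact mem_image_of_mem F x.2
    · convert! (IsEmbedding.subtypeVal :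
        IsEmbedding (Subtype.val : diskCotangentCylinder a → SympSpace 3)) using 1
      exact funext fun x => hgF x.2
  · exact ((pullbackStdForm_cyl hs x).trans
      (hform _ (norm_cylBase x) _ (extChartAt_mem_cylTarget x))).trans
      (diskCotangentBundle_form x).symm

/-! ### Balls inside the disk cotangent bundle -/

theorem isOpen_cylTarget (a : ℝ) : IsOpen (cylTarget a) := by
  refine IsOpen.inter (isOpen_Ioo.preimage (by fun_prop)) (IsOpen.inter ?_ ?_)
  · exact isOpen_lt (f := fun y : SympSpace 2 => |y.1 1|) (by fun_prop) continuous_const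
  · exact isOpen_lt (f := fun y : SympSpace 2 => y.2 0 ^ 2 + y.2 1 ^ 2) (by fun_prop)
      continuous_const

/-- The embedding is the inverse of the chart centred in the direction `1`. Allowing `a ≤ b` lets
the half-length `π` serve all longer cylinders. -/
theorem exists_isSymplecticEmbedding_cylTarget {a b : ℝ} (ha : 0 < a) (hab : a ≤ b) :
    ∃ φ, IsSymplecticEmbedding (.ofOpen ⟨cylTarget a, isOpen_cylTarget a⟩)
      (diskCotangentBundle b) φ := by
  have hmem : ∀ y ∈ cylTarget a, y ∈ cylTarget b := fun y hy =>
    ⟨hy.1, hy.2.1.trans_le hab, hy.2.2⟩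
  let x₀ : diskCotangentCylinder b := ⟨cylParam 1 0, cylParam_mem (by simp)
    (by simpa using ha.trans_le hab) (by simp)⟩
  have hx₀ : cylBase x₀ = 1 := by
    apply Complex.ext <;> simp [cylBase, x₀, cylParam]
  let U : TopologicalSpace.Opens (SympSpace 2) := ⟨cylTarget a, isOpen_cylTarget a⟩
  let φ : U → diskCotangentCylinder b := fun y => (cylChart b x₀).symm y
  have hval : ∀ y : U, (φ y : SympSpace 3) = cylParam 1 y := fun y => by
    rw [← hx₀]; exact cylChart_symm_val x₀ (hmem y y.2)
  have hs : ContMDiff 𝓘(ℝ, SympSpace 2) 𝓘(ℝ, SympSpace 2) ∞ φ :=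
    (contMDiffOn_chart_symm (I := 𝓘(ℝ, SympSpace 2)) (x := x₀)).comp_contMDiff
      contMDiff_subtype_val fun y => hmem y y.2
  have hv : (Subtype.val ∘ φ : U → SympSpace 3) = fun y : U => cylParam 1 y := funext hval
  have hc : ContMDiff 𝓘(ℝ, SympSpace 2) 𝓘(ℝ, SympSpace 3) ∞ (fun y : U => cylParam 1 y) :=
    contMDiff_restrict fun y _ => (contDiff_cylParam 1).contDiffAt
  refine ⟨φ, hs, ?_, fun y : U => ?_⟩
  · refine isEmbedding_of_comp_continuousOn (g := fun x : diskCotangentCylinder b => cylChart b x₀ x)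
      hs.continuous ((cylChart b x₀).continuousOn.mono ?_) ?_
    · rintro _ ⟨y : U, rfl⟩
      exact (cylChart b x₀).map_target (hmem y y.2)
    · convert! (IsEmbedding.subtypeVal : IsEmbedding (Subtype.val : U → SympSpace 2)) using 1
      exact funext fun y : U => (cylChart b x₀).right_inv (hmem y y.2)
  · refine (pullbackStdForm_comp hs (contMDiff_cylInclusion b) y).trans ?_
    rw [hv]
    exact ((pullbackStdForm_restrict hc y).trans
      (stdForm_fderiv_cylParam (by simp) _)).trans (ofOpen_form U y).symm

theorem exists_isSymplecticEmbedding_ball_cylTarget {a r : ℝ} (ha : 0 < a) (haπ : a ≤ Real.pi)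
    (hr : r < 4 * a) : ∃ φ, IsSymplecticEmbedding (sympBall 2 r)
      (.ofOpen ⟨cylTarget a, isOpen_cylTarget a⟩) φ := by
  have hπ := Real.pi_pos
  -- The scale `b` stretches the range `(-π/2, π/2)` of `arcsin` to `(-a, a)`. The slack `k` solves
  -- `r / (2π) + 2k = b`, and is positive exactly when `r < 4a`.
  obtain ⟨k, hk⟩ : ∃ k, k = (4 * a - r) / (4 * Real.pi) := ⟨_, rfl⟩
  obtain ⟨b, hb⟩ : ∃ b, b = 2 * a / Real.pi := ⟨_, rfl⟩
  have hk0 : 0 < k := hk ▸ div_pos (by linarith) (by linarith)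
  have hb0 : 0 < b := hb ▸ by positivity
  have hba : b * (Real.pi / 2) = a := by rw [hb]; field_simp
  refine exists_isSymplecticEmbedding_ofOpen (f := planeProd 1 fun _ => squaringMap k b)
    (g := planeProd 1 fun _ => squaringInv k b)
    (fun y _ => contDiffAt_planeProd fun i => (isAreaPreservingAt_squaringMap hk0 _ hb0).1)
    (fun y hy => ?_) ?_ (fun y _ => ?_)
    fun y _ => stdForm_comp_fderiv_planeProd fun i => isAreaPreservingAt_squaringMap hk0 _ hb0
  · have hy : ∑ i, y.1 i ^ 2 + ∑ i, y.2 i ^ 2 < r / Real.pi := hy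
    have h0 := abs_squaringMap_fst_lt hk0 hb0 (y.1 0, y.2 0)
    have h1 := abs_squaringMap_fst_lt hk0 hb0 (y.1 1, y.2 1)
    have h2 := mul_abs_squaringMap_snd_le hk0 hb0 (y.1 0, y.2 0)
    have h3 := mul_abs_squaringMap_snd_le hk0 hb0 (y.1 1, y.2 1)
    rw [hba] at h0 h1
    -- The angular coordinate also lies in `(-a, a)`; `a ≤ π` makes this fit into one turn of the
    -- circle.
    refine ⟨abs_lt.1 (h0.trans_le haπ), h1, ?_⟩
    show (squaringMap k b (y.1 0, y.2 0)).2 ^ 2 + (squaringMap k b (y.1 1, y.2 1)).2 ^ 2 < 1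
    simp only [Fin.sum_univ_two] at hy
    have h4 : b = r / Real.pi / 2 + 2 * k := by rw [hb, hk]; field_simp; ring
    -- The two momentum bounds add up to `I_1 + I_2 + 2k < r / (2π) + 2k = b`. The resulting `ℓ¹`
    -- bound implies the Euclidean one.
    have h5 : |(squaringMap k b (y.1 0, y.2 0)).2| + |(squaringMap k b (y.1 1, y.2 1)).2| < 1 := by
      refine lt_of_mul_lt_mul_left (a := b) ?_ hb0.le
      simp only at h2 h3
      linarith
    rw [← sq_abs, ← sq_abs (squaringMap k b (y.1 1, y.2 1)).2]
    nlinarith [abs_nonneg (squaringMap k b (y.1 0, y.2 0)).2,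
      abs_nonneg (squaringMap k b (y.1 1, y.2 1)).2]
  · rintro _ ⟨y, -, rfl⟩
    have hg : ∀ i, ContinuousAt (squaringInv k b) (squaringMap k b (y.1 i, y.2 i)) := fun i => by
      refine continuousAt_squaringInv hk0 (Real.cos_pos_of_mem_Ioo (abs_lt.1 ?_)).ne'
      rw [abs_div, abs_of_pos hb0, div_lt_iff₀' hb0]
      exact abs_squaringMap_fst_lt hk0 hb0 _
    have hg' : ∀ i, ContinuousAt (fun y : SympSpace 2 => squaringInv k b (y.1 i, y.2 i))
        (planeProd 1 (fun _ => squaringMap k b) y) := fun i =>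
      ContinuousAt.comp_of_eq (f := fun y : SympSpace 2 => (y.1 i, y.2 i)) (hg i)
        (by fun_prop) rfl
    exact ((continuousAt_pi.2 fun i => (hg' i).fst).prodMk
      (continuousAt_pi.2 fun i => (hg' i).snd)).continuousWithinAt
  · have h : ∀ i, squaringInv k b (squaringMap k b (y.1 i, y.2 i)) = (y.1 i, y.2 i) := fun i =>
      squaringInv_squaringMap hk0 hb0 _
    exact Prod.ext (funext fun i => congrArg Prod.fst (h i))
      (funext fun i => congrArg Prod.snd (h i))

/-! ### Plane coordinates on the annulus factor, and product embeddings -/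

/-- The point `(sin θ, cos θ)` scaled to the squared radius `2 (p_θ + 1)`. -/
noncomputable def cylPlane (x : SympSpace 3) : ℝ × ℝ :=
  (√(2 * ((x.1 0 * x.2 1 - x.1 1 * x.2 0) + 1)) * x.1 1,
    √(2 * ((x.1 0 * x.2 1 - x.1 1 * x.2 0) + 1)) * x.1 0)

/-- In each angular chart `cylPlane` is a polar map shifted by the angle of `w`. The angle enters
only through sine and cosine, so the map is global although `θ` is not. -/
theorem cylPlane_cylParam {w : ℂ} (hw : ‖w‖ = 1) (y : SympSpace 2) :
    cylPlane (cylParam w y) = polarMap 1 w.arg (y.1 0, y.2 0) := by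
  have hw0 : w ≠ 0 := by rintro rfl; simp at hw
  have hre : w.re = Real.cos w.arg := by rw [Complex.cos_arg hw0, hw, div_one]
  have him : w.im = Real.sin w.arg := by rw [Complex.sin_arg, hw, div_one]
  have hcs := Real.sin_sq_add_cos_sq w.arg
  have hcs' := Real.sin_sq_add_cos_sq (y.1 0)
  have hp : (cylParam w y).1 0 * (cylParam w y).2 1 - (cylParam w y).1 1 * (cylParam w y).2 0 =
      y.2 0 := by
    simp only [cylParam, Matrix.cons_val_zero, Matrix.cons_val_one]
    rw [hre, him]
    linear_combination y.2 0 *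
      (Real.sin (y.1 0) ^ 2 + Real.cos (y.1 0) ^ 2) * hcs + y.2 0 * hcs'
  unfold cylPlane polarMap
  rw [hp]
  simp only [cylParam, Matrix.cons_val_zero, Matrix.cons_val_one, one_mul, div_one, Real.sin_add,
    Real.cos_add]
  rw [hre, him]
  ext <;> simp only <;> ring

section
variable {a : ℝ} {x : SympSpace 3}

/-- The horizontal part of `p` is orthogonal to the unit vector `(q_1, q_2)`, so its squared length
is the square of the angular momentum. -/
theorem sq_angularMomentum_le (hx : x ∈ diskCotangentCylinder a) :
    (x.1 0 * x.2 1 - x.1 1 * x.2 0) ^ 2 + x.2 2 ^ 2 < 1 := by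
  obtain ⟨⟨h1, -⟩, h3, h4⟩ := hx
  have : (x.1 0 * x.2 1 - x.1 1 * x.2 0) ^ 2 = x.2 0 ^ 2 + x.2 1 ^ 2 := by
    linear_combination (x.2 0 ^ 2 + x.2 1 ^ 2) * h1 - (x.1 0 * x.2 0 + x.1 1 * x.2 1) * h3
  linarith

theorem abs_angularMomentum_lt (hx : x ∈ diskCotangentCylinder a) :
    |x.1 0 * x.2 1 - x.1 1 * x.2 0| < 1 := by
  rw [← sq_lt_one_iff_abs_lt_one]
  nlinarith [sq_angularMomentum_le hx, sq_nonneg (x.2 2)]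

theorem abs_axialMomentum_lt (hx : x ∈ diskCotangentCylinder a) : |x.2 2| < 1 := by
  rw [← sq_lt_one_iff_abs_lt_one]
  nlinarith [sq_angularMomentum_le hx, sq_nonneg (x.1 0 * x.2 1 - x.1 1 * x.2 0)]

theorem sq_cylPlane (hx : x ∈ diskCotangentCylinder a) :
    (cylPlane x).1 ^ 2 + (cylPlane x).2 ^ 2 = 2 * ((x.1 0 * x.2 1 - x.1 1 * x.2 0) + 1) := by
  have h := abs_lt.1 (abs_angularMomentum_lt hx)
  have hsq := Real.sq_sqrt (show 0 ≤ 2 * ((x.1 0 * x.2 1 - x.1 1 * x.2 0) + 1) by linarith)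
  unfold cylPlane
  simp only
  rw [mul_pow, mul_pow, hsq]
  linear_combination 2 * ((x.1 0 * x.2 1 - x.1 1 * x.2 0) + 1) * hx.1.1

/-- Angular momentum above `-1` keeps the squared radius positive, away from the singularity of the
root. -/
theorem contDiffAt_cylPlane (hx : x ∈ diskCotangentCylinder a) :
    ContDiffAt ℝ ∞ cylPlane x := by
  have h := abs_lt.1 (abs_angularMomentum_lt hx)
  have hs : ContDiffAt ℝ ∞
      (fun x : SympSpace 3 => √(2 * ((x.1 0 * x.2 1 - x.1 1 * x.2 0) + 1))) x :=
    ContDiffAt.sqrt (ContDiff.contDiffAt (by fun_prop)) (by linarith)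
  exact (hs.mul (ContDiff.contDiffAt (by fun_prop))).prodMk
    (hs.mul (ContDiff.contDiffAt (by fun_prop)))

end

/-- The point of `D^*C_a` with the values `u` of `cylPlane` and `v` of `(z, p_z)`. -/
noncomputable def cylPlaneInv (u v : ℝ × ℝ) : SympSpace 3 :=
  (![u.2 / √(u.1 ^ 2 + u.2 ^ 2), u.1 / √(u.1 ^ 2 + u.2 ^ 2), v.1],
    ![-(((u.1 ^ 2 + u.2 ^ 2) / 2 - 1) * (u.1 / √(u.1 ^ 2 + u.2 ^ 2))),
      ((u.1 ^ 2 + u.2 ^ 2) / 2 - 1) * (u.2 / √(u.1 ^ 2 + u.2 ^ 2)), v.2])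

theorem cylPlaneInv_cylPlane {a : ℝ} {x : SympSpace 3} (hx : x ∈ diskCotangentCylinder a) :
    cylPlaneInv (cylPlane x) (x.1 2, x.2 2) = x := by
  have h := abs_lt.1 (abs_angularMomentum_lt hx)
  have hR : 0 < √(2 * ((x.1 0 * x.2 1 - x.1 1 * x.2 0) + 1)) := Real.sqrt_pos.2 (by linarith)
  unfold cylPlaneInv
  rw [sq_cylPlane hx]
  obtain ⟨⟨h1, -⟩, h3, -⟩ := hx
  simp only [cylPlane, mul_div_cancel_left₀ _ hR.ne']
  refine Prod.ext (funext fun i => ?_) (funext fun i => ?_) <;> fin_cases i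
  · rfl
  · rfl
  · rfl
  · simp
    linear_combination x.2 0 * h1 - x.1 0 * h3
  · simp
    linear_combination x.2 1 * h1 - x.1 1 * h3
  · rfl

/-- Common source of both upper bounds: `cylPlane` on `(θ, p_θ)` times a freely chosen `σ` on `(z,
p_z)`, with `τ` undoing `σ`. The permutation `e` decides which factor occupies the plane constrained
by the cylinder. -/
theorem exists_isSymplecticEmbedding_diskCotangentBundle_prod {a : ℝ} (e : Equiv.Perm (Fin 2))
    {σ τ : ℝ × ℝ → ℝ × ℝ}
    (hσ : ∀ z : ℝ × ℝ, |z.1| < a → |z.2| < 1 → IsAreaPreservingAt σ z)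
    (hτ : ∀ z : ℝ × ℝ, |z.1| < a → |z.2| < 1 → ContinuousAt τ (σ z) ∧ τ (σ z) = z)
    {V : TopologicalSpace.Opens (SympSpace 2)}
    (hV : ∀ x ∈ diskCotangentCylinder a,
      ((fun i => (![cylPlane x, σ (x.1 2, x.2 2)] (e i)).1,
        fun i => (![cylPlane x, σ (x.1 2, x.2 2)] (e i)).2) : SympSpace 2) ∈ V) :
    ∃ φ, IsSymplecticEmbedding (diskCotangentBundle a) (.ofOpen V) φ := by
  refine exists_isSymplecticEmbedding_diskCotangentBundle_ofOpen (g := fun y =>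
    cylPlaneInv (y.1 (e.symm 0), y.2 (e.symm 0)) (τ (y.1 (e.symm 1), y.2 (e.symm 1))))
    (fun x hx => ?_) hV ?_ (fun x hx => ?_) fun w hw y hy => ?_
  · have h : ∀ j : Fin 2, ContDiffAt ℝ ∞
        (fun x : SympSpace 3 => ![cylPlane x, σ (x.1 2, x.2 2)] j) x := by
      intro j
      fin_cases j
      · exact contDiffAt_cylPlane hx
      · exact ContDiffAt.comp (f := fun x : SympSpace 3 => (x.1 2, x.2 2)) x
          (hσ _ hx.1.2 (abs_axialMomentum_lt hx)).1 (ContDiff.contDiffAt (by fun_prop))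
    exact (contDiffAt_pi.2 fun i => (h (e i)).fst).prodMk
      (contDiffAt_pi.2 fun i => (h (e i)).snd)
  · rintro _ ⟨x, hx, rfl⟩
    refine ContinuousAt.continuousWithinAt ?_
    have h := abs_lt.1 (abs_angularMomentum_lt hx)
    have hu : √((cylPlane x).1 ^ 2 + (cylPlane x).2 ^ 2) ≠ 0 := by
      rw [sq_cylPlane hx]
      exact (Real.sqrt_pos.2 (by linarith)).ne'
    have hinv : ContinuousAt (fun p : (ℝ × ℝ) × (ℝ × ℝ) => cylPlaneInv p.1 p.2)
        (cylPlane x, (x.1 2, x.2 2)) := by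
      unfold cylPlaneInv
      refine ContinuousAt.prodMk (continuousAt_pi.2 fun i => ?_) (continuousAt_pi.2 fun i => ?_) <;>
        fin_cases i <;> simp <;> fun_prop (disch := exact hu)
    obtain ⟨hc, heq⟩ := hτ (x.1 2, x.2 2) hx.1.2 (abs_axialMomentum_lt hx)
    refine ContinuousAt.comp_of_eq (f := fun y : SympSpace 2 =>
      ((y.1 (e.symm 0), y.2 (e.symm 0)), τ (y.1 (e.symm 1), y.2 (e.symm 1)))) hinv
      (ContinuousAt.prodMk (by fun_prop) (ContinuousAt.comp_of_eq (f := fun y : SympSpace 2 =>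
        (y.1 (e.symm 1), y.2 (e.symm 1))) hc (by fun_prop) ?_)) ?_
    · simp
    · simp [heq]
  · have heq := (hτ (x.1 2, x.2 2) hx.1.2 (abs_axialMomentum_lt hx)).2
    simp [heq, cylPlaneInv_cylPlane hx]
  · have hcomp : (fun x : SympSpace 3 => ((fun i => (![cylPlane x, σ (x.1 2, x.2 2)] (e i)).1,
        fun i => (![cylPlane x, σ (x.1 2, x.2 2)] (e i)).2) : SympSpace 2)) ∘ cylParam w =
        planeProd e fun i => ![polarMap 1 w.arg, σ] (e i) := by
      funext y
      have h : ∀ j : Fin 2, ![cylPlane (cylParam w y), σ ((cylParam w y).1 2, (cylParam w y).2 2)] j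
          = ![polarMap 1 w.arg, σ] j (y.1 j, y.2 j) := by
        intro j
        fin_cases j
        · exact cylPlane_cylParam hw y
        · rfl
      exact Prod.ext (funext fun i => congrArg Prod.fst (h (e i)))
        (funext fun i => congrArg Prod.snd (h (e i)))
    rw [hcomp]
    refine stdForm_comp_fderiv_planeProd fun i => ?_
    have h : ∀ j : Fin 2, IsAreaPreservingAt (![polarMap 1 w.arg, σ] j) (y.1 j, y.2 j) := by
      have h2 := hy.2.2
      intro j
      fin_cases j
      · exact isAreaPreservingAt_polarMap one_pos _ (show -1 < y.2 0 by nlinarith [sq_nonneg (y.2 1)])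
      · exact hσ _ hy.2.1 (by
          rw [← sq_lt_one_iff_abs_lt_one]
          exact (le_add_of_nonneg_left (sq_nonneg _)).trans_lt h2)
    exact h (e i)

/-! ### The capacity of `D^*C_a` -/

/-- Angular momentum below `1` bounds the squared radius of `cylPlane` by `4`, which is area `4π`.
-/
theorem exists_isSymplecticEmbedding_sympCylinder_four_pi (a : ℝ) :
    ∃ φ, IsSymplecticEmbedding (diskCotangentBundle a) (sympCylinder 2 (4 * Real.pi)) φ := by
  refine exists_isSymplecticEmbedding_diskCotangentBundle_prod 1 (σ := id) (τ := id)
    (fun z _ _ => isAreaPreservingAt_id z) (fun z _ _ => ⟨continuousAt_id, rfl⟩) fun x hx => ?_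
  show (cylPlane x).1 ^ 2 + (cylPlane x).2 ^ 2 < 4 * Real.pi / Real.pi
  have h := abs_lt.1 (abs_angularMomentum_lt hx)
  rw [sq_cylPlane hx, mul_div_cancel_right₀ _ Real.pi_ne_zero]
  linarith

/-- The inverse of `polarMap b 0` away from the angle `π`. -/
noncomputable def polarInv (b : ℝ) (z : ℝ × ℝ) : ℝ × ℝ :=
  ((Complex.equivRealProdCLM.symm (z.2, z.1)).arg / b, b * (z.1 ^ 2 + z.2 ^ 2) / 2 - 1)

theorem sq_polarMap {b : ℝ} (hb : 0 < b) {z : ℝ × ℝ} (hz : -1 < z.2) (s : ℝ) :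
    (polarMap b s z).1 ^ 2 + (polarMap b s z).2 ^ 2 = 2 * (z.2 + 1) / b := by
  have hsq := Real.sq_sqrt (show 0 ≤ 2 * (z.2 + 1) / b from div_nonneg (by linarith) hb.le)
  unfold polarMap
  simp only
  rw [mul_pow, mul_pow, hsq, ← mul_add, Real.sin_sq_add_cos_sq, mul_one]

theorem polarInv_polarMap {b : ℝ} (hb : 0 < b) {z : ℝ × ℝ} (hz : |b * z.1| < Real.pi)
    (hz' : -1 < z.2) :
    ContinuousAt (polarInv b) (polarMap b 0 z) ∧ polarInv b (polarMap b 0 z) = z := by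
  have hR : 0 < √(2 * (z.2 + 1) / b) := Real.sqrt_pos.2 (div_pos (by linarith) hb)
  have hmem := abs_lt.1 hz
  have he : Complex.equivRealProdCLM.symm ((polarMap b 0 z).2, (polarMap b 0 z).1) =
      (√(2 * (z.2 + 1) / b) : ℝ) *
        (Complex.cos (b * z.1 : ℝ) + Complex.sin (b * z.1 : ℝ) * Complex.I) := by
    rw [← Complex.ofReal_cos, ← Complex.ofReal_sin]
    apply Complex.ext <;>
      simp [polarMap, -Complex.ofReal_mul, -Complex.ofReal_cos, -Complex.ofReal_sin]
  have harg : (Complex.equivRealProdCLM.symm ((polarMap b 0 z).2, (polarMap b 0 z).1)).arg =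
      b * z.1 := by
    rw [he, Complex.arg_mul_cos_add_sin_mul_I hR ⟨hmem.1, hmem.2.le⟩]
  -- The angle stays strictly between `-π` and `π`, so the image avoids the cut on which `arg` is
  -- discontinuous.
  have hslit : Complex.equivRealProdCLM.symm ((polarMap b 0 z).2, (polarMap b 0 z).1) ∈
      Complex.slitPlane := by
    rw [Complex.mem_slitPlane_iff_arg, harg]
    refine ⟨hmem.2.ne, fun h0 => ?_⟩
    have h1 := sq_polarMap hb hz' 0
    have h2 : ((polarMap b 0 z).2, (polarMap b 0 z).1) = 0 := by simpa using h0
    rw [Prod.mk_eq_zero] at h2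
    rw [h2.1, h2.2] at h1
    have : 0 < 2 * (z.2 + 1) / b := div_pos (by linarith) hb
    norm_num at h1
    linarith
  constructor
  · refine ContinuousAt.prodMk (ContinuousAt.div_const ?_ b) (by fun_prop)
    exact ContinuousAt.comp_of_eq (f := fun z : ℝ × ℝ => Complex.equivRealProdCLM.symm (z.2, z.1))
      (Complex.continuousAt_arg hslit) (by fun_prop) rfl
  · unfold polarInv
    rw [harg, sq_polarMap hb hz']
    ext
    · simp only
      field_simp
    · simp only
      field_simp
      ring

/-- The angular speed `π / a` spreads `|z| < a` over one full turn, and `p_z < 1` bounds the squared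
radius by `4a / π`. The swap makes this disc the first factor. -/
theorem exists_isSymplecticEmbedding_sympCylinder_four_mul {a : ℝ} (ha : 0 < a) :
    ∃ φ, IsSymplecticEmbedding (diskCotangentBundle a) (sympCylinder 2 (4 * a)) φ := by
  have hπ := Real.pi_pos
  have hb : 0 < Real.pi / a := div_pos hπ ha
  refine exists_isSymplecticEmbedding_diskCotangentBundle_prod (Equiv.swap 0 1)
    (σ := polarMap (Real.pi / a) 0) (τ := polarInv (Real.pi / a))
    (fun z _ hz => isAreaPreservingAt_polarMap hb 0 (abs_lt.1 hz).1)
    (fun z hz hz' => polarInv_polarMap hb ?_ (abs_lt.1 hz').1) fun x hx => ?_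
  · rw [abs_mul, abs_of_pos hb, div_mul_eq_mul_div, div_lt_iff₀ ha]
    exact mul_lt_mul_of_pos_left hz hπ
  · have h := abs_lt.1 (abs_axialMomentum_lt hx)
    show (polarMap (Real.pi / a) 0 (x.1 2, x.2 2)).1 ^ 2 +
      (polarMap (Real.pi / a) 0 (x.1 2, x.2 2)).2 ^ 2 < 4 * a / Real.pi
    rw [sq_polarMap hb h.1, div_div_eq_mul_div]
    refine div_lt_div_of_pos_right ?_ hπ
    simp only
    nlinarith

theorem le_capacity_diskCotangentBundle {c : SymplecticManifold 2 → ℝ≥0∞}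
    (hc : IsNormalizedSymplecticCapacity 2 c) {a b : ℝ} (ha : 0 < a) (haπ : a ≤ Real.pi)
    (hab : a ≤ b) : ENNReal.ofReal (4 * a) ≤ c (diskCotangentBundle b) := by
  -- Only balls with `r < 4a` are embedded, so the bound is obtained as a supremum.
  refine le_of_forall_lt fun t ht => ?_
  obtain ⟨r, hr, hra⟩ := ENNReal.lt_iff_exists_real_btwn.1 ht |>.imp fun r h => h.2
  have hr' : r < 4 * a := (ENNReal.ofReal_lt_ofReal_iff (by linarith)).1 hra
  have hr0 : 0 < r := ENNReal.ofReal_pos.1 (bot_le.trans_lt hr)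
  exact hr.trans_le ((hc.le_ball hr0).trans
    ((hc.monotone _ _ (exists_isSymplecticEmbedding_ball_cylTarget ha haπ hr')).trans
      (hc.monotone _ _ (exists_isSymplecticEmbedding_cylTarget ha hab))))

theorem mainTheorem5 (c : SymplecticManifold 2 → ℝ≥0∞) (hc : IsNormalizedSymplecticCapacity 2 c)
    (a : ℝ) (ha : 0 < a) :
    (a ≤ Real.pi → c (diskCotangentBundle a) = ENNReal.ofReal (4 * a)) ∧
    (Real.pi ≤ a → c (diskCotangentBundle a) = ENNReal.ofReal (4 * Real.pi)) := by
  have hπ := Real.pi_pos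
  -- Both lower bounds come from one lemma: with half-length `a` itself in the first case, and with
  -- half-length `π` inside the longer cylinder in the second.
  refine ⟨fun h => le_antisymm ?_ (le_capacity_diskCotangentBundle hc ha h le_rfl),
    fun h => le_antisymm ?_ (le_capacity_diskCotangentBundle hc hπ le_rfl h)⟩
  · exact (hc.monotone _ _ (exists_isSymplecticEmbedding_sympCylinder_four_mul ha)).trans
      (hc.cylinder_le (by linarith))
  · exact (hc.monotone _ _ (exists_isSymplecticEmbedding_sympCylinder_four_pi a)).trans
      (hc.cylinder_le (by linarith))
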